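/- **Setting.** All systems are finite-dimensional, entropies $H$ are von Neumann entropies in nats, $k_B>0$. An error-correcting engine consists of a reference $R$, a system $S$, an ancilla $A$ with energy eigenbasis $|x\rangle$ and energies $\varepsilon_x$, a hot bath $B_h$ (temperature $T_h$), a cold bath $B_c=A'C$ (temperature $T_c$, $0<T_c\le T_h$; $A'$ is a copy of $A$, not interacting with $C$), a measurement apparatus $M$ (temperature $T_m>0$), and classical registers $X,Y$; $Y$ starts in its ground state $|0\rangle$. The bath, ancilla and apparatus start in thermal states $\tau$, uncorrelated with an arbitrary pure state $\psi^{RS}$. The Hamiltonian of $R$ is zero; that of $SA$ is $\mathscr H^S+\mathscr H^A$ at the beginning and after the correction, and some $\mathscr H^{SA}$ in between. The cycle is: 1. $A$ is measured in its energy basis; the outcome $x$, with probability $p_X(x)=e^{-\varepsilon_x/k_BT_c}/Z$, is stored in $X$. 2. Encoding by a unitary $U_{\mathrm{enc},x}^{SA}$. 3. Noise: a unitary $U^{SAB_h}$ that commutes with $\mathscr H^{SA}+\mathscr H^{B_h}$. The state of $E=RSAB_hB_c$ is now $\sigma^E_{1,x}$. 4. Syndrome measurement, given $x$: a unitary on $SAM$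 followed by projectors $P_{y|x}^M$ whose outcome $y$ is copied into $Y$ by $\sum_yP^M_{y|x}\otimes V_y$, $V_y|0\rangle=|y\rangle$. This defines an instrument $\{\mathcal N_{y|x}\}_y$ and the map $\mathcal N_{|x}=\sum_y\mathcal N_{y|x}\otimes|y\rangle\langle y|$ (state $\sigma_2$). 5. Correction by unitaries $U_{\mathrm{dec},xy}^{SA}$ (state $\sigma_3$). 6. $A$ is swapped with $A'$ (state $\sigma_f$); then $X,Y$ are discarded and $Y$ is reset to $|0\rangle$. Heats: $Q_h,Q_c,Q_{\rm meas}$ are the losses of mean energy of $B_h,B_c,M$; $Q^Y_{\rm erase}=\langle\mathscr H^Y\rangle_i-\langle\mathscr H^Y\rangle_f$; $Q^Y_{\rm meas}=k_BT_m[\Delta H(Y|X)-I(Y:M|X)_{\sigma_2}]$ and $Q^{RSA|Y}_{\rm meas}=k_BT_m[\Delta H(RSA|XY)-I(RSA:M|XY)_{\sigma_2}]$, with $\Delta$ the change in step 4; $Q_{\rm input}=Q_h+Q^Y_{\rm meas}$. The work $W_{\rm tot}=W_{\rm enc}+W_{\rm meas}+W_{\rm dec}$ is the increase of the internal energy of $RSAY$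 in steps 2, 4 and 5, less $Q_{\rm meas}$. Put $\eta=-W_{\rm tot}/Q_{\rm input}$, $\eta_C=1-T_c/T_h$. The efficacy is $\mathscr E(\mathcal N_{|x};\sigma^E_{1,x})=\operatorname{Tr}[\mathcal N_{|x}^\dagger\circ\mathcal N_{|x}(\sigma^E_{1,x})]$. The entanglement fidelity is $F_e=\langle\psi|\sigma_f^{RS}|\psi\rangle$, the entropy exchange $S_e=H(RS)_{\sigma_f}$, and the maximal achievable entanglement fidelity $F_e^\star$ is the largest $F\in[0,1]$ with $-F\ln F-(1-F)\ln(1-F)+(1-F)\ln(d^2-1)\ge S_e$, $d=\dim(\mathcal H_S\otimes\mathcal H_R)$. **Statement.** Let the engine work in the heat-engine regime $Q_h\ge0$, $Q_c\le0$, $Q^{RSA|Y}_{\rm meas}\le0$, $Q_{\rm input}>0$. Let $0\le\epsilon<1$ be a relative tolerance within which the following assumptions hold: 1. $|\Delta\mathscr U^{RSAY}|\ll Q_{\rm input}$ over the cycle, i.e. $|\Delta\mathscr U^{RSAY}|\le\epsilon\,Q_{\rm input}$; 2. $H(X|E)_{\sigma_f}\ll H(Y|EX)_{\sigma_f}$,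 i.e. $H(X|E)_{\sigma_f}\le\epsilon\,H(Y|EX)_{\sigma_f}$; 3. $|Q^Y_{\rm erase}|\approx k_BT_cH(Y|X)_{\sigma_2}$, i.e. the two differ by at most $\epsilon\,k_BT_cH(Y|X)_{\sigma_2}$; 4. $|Q^{RSA|Y}_{\rm meas}|\ge\frac{T_c}{T_h}Q^Y_{\rm meas}$. Suppose that the syndrome instrument has efficacy at most one: $\mathscr E(\mathcal N_{|x};\sigma^E_{1,x})\le1$ for all $x$ (average negative log efficacy non-negative). Then $F_e\le F_e^\star$, and with $\delta(\epsilon)=\epsilon+\frac{2\epsilon(1+\epsilon)}{1-\epsilon}$, $$\eta>\eta_C+\delta(\epsilon)\;\Rightarrow\;F_e^\star<1,\qquad\text{equivalently}\qquad F_e^\star=1\;\Rightarrow\;\eta\le\eta_C+\delta(\epsilon).$$ In particular, when the approximations are exact ($\epsilon=0$), $\eta>\eta_C\Rightarrow F_e^\star<1$, and $F_e^\star=1\Rightarrow\eta\le\eta_C$. -/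

import Mathlib

open scoped Kronecker

set_option synthInstance.maxSize 2048

noncomputable section

namespace QECEngine

/-! ### Finite-dimensional quantum systems

A quantum system with orthonormal basis `I` has the operators `Matrix I I ℂ`. -/

/-- The operator `T` on a subsystem `K` of `I = K × L`, extended by the identity on `L`. -/
def extend {I K L : Type*} [DecidableEq L] (e : I ≃ K × L) (T : Matrix K K ℂ) : Matrix I I ℂ :=
  (T ⊗ₖ (1 : Matrix L L ℂ)).submatrix e e

/-- The reduced operator on the subsystem `K` of `I = K × L` (partial trace over `L`). -/
def reduce {I K L : Type*} [Fintype L] (e : I ≃ K × L) (ρ : Matrix I I ℂ) : Matrix K K ℂ :=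
  Matrix.of fun k k' => ∑ l, ρ (e.symm (k, l)) (e.symm (k', l))

/-- `V ρ V†`. -/
def evolve {I : Type*} [Fintype I] (V ρ : Matrix I I ℂ) : Matrix I I ℂ :=
  V * ρ * V.conjTranspose

/-- `|v⟩⟨v|`. -/
def pureState {I : Type*} (v : I → ℂ) : Matrix I I ℂ := Matrix.vecMulVec v (star v)

/-- The expectation `Tr[ρ H]` of an observable. -/
def expectation {I : Type*} [Fintype I] (H ρ : Matrix I I ℂ) : ℝ := (ρ * H).trace.re

/-- The von Neumann entropy `-Tr[ρ ln ρ]` (with `0 ln 0 = 0`). -/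
def entropy {I : Type*} [Fintype I] [DecidableEq I] (ρ : Matrix I I ℂ) : ℝ :=
  -(ρ * cfc Real.log ρ).trace.re

/-- The thermal state `exp(-H / θ) / Tr[exp(-H / θ)]`, where `θ` is `k_B` times the temperature. -/
def thermal {I : Type*} [Fintype I] [DecidableEq I] (θ : ℝ) (H : Matrix I I ℂ) : Matrix I I ℂ :=
  (cfc (fun e : ℝ => Real.exp (-e / θ)) H).trace⁻¹ • cfc (fun e : ℝ => Real.exp (-e / θ)) H

/-- The adjoint of a linear map between operator spaces for the pairing `Tr[M N]`. -/
def traceAdjoint {I J : Type*} [Fintype J] [DecidableEq I]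
    (Φ : Matrix I I ℂ → Matrix J J ℂ) (T : Matrix J J ℂ) : Matrix I I ℂ :=
  Matrix.of fun i j => (T * Φ (Matrix.single j i 1)).trace

theorem trace_traceAdjoint_mul {I J : Type*} [Fintype I] [Fintype J] [DecidableEq I]
    (Φ : Matrix I I ℂ →ₗ[ℂ] Matrix J J ℂ) (T : Matrix J J ℂ) (N : Matrix I I ℂ) :
    (traceAdjoint Φ T * N).trace = (T * Φ N).trace := by
  conv_rhs => rw [Matrix.matrix_eq_sum_single N]
  have h : ∀ i j, Matrix.single i j (N i j) = N i j • Matrix.single i j (1 : ℂ) := by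
    intro i j; simp [Matrix.smul_single]
  simp only [h, map_sum, map_smul, Matrix.mul_sum, Matrix.trace_sum, Matrix.mul_smul,
    Matrix.trace_smul, smul_eq_mul]
  rw [Finset.sum_comm]
  simp only [Matrix.trace, Matrix.diag, Matrix.mul_apply (M := traceAdjoint Φ T)]
  refine Finset.sum_congr rfl fun j _ => Finset.sum_congr rfl fun i _ => ?_
  simp [traceAdjoint, Matrix.trace, mul_comm]

/-- The efficacy `Tr[Φ†(Φ(ρ))]` of a linear map `Φ` with respect to `ρ`. -/
def efficacy {I J : Type*} [Fintype I] [Fintype J] [DecidableEq I]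
    (Φ : Matrix I I ℂ → Matrix J J ℂ) (ρ : Matrix I I ℂ) : ℝ :=
  (traceAdjoint Φ (Φ ρ)).trace.re

/-- The largest `F ∈ [0, 1]` that satisfies the quantum Fano inequality
`H(F) + (1 - F) ln (d² - 1) ≥ s`. -/
def fanoMaximum (d : ℕ) (s : ℝ) : ℝ :=
  sSup {F : ℝ | 0 ≤ F ∧ F ≤ 1 ∧ s ≤ Real.binEntropy F + (1 - F) * Real.log ((d : ℝ) ^ 2 - 1)}

/-! ### The engine

`R` reference, `S` system, `A` ancilla (its index is also the value of the classical register `X`),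
`B` hot bath, `A × C` cold bath (a fresh copy of `A` and the rest), `M` measurement apparatus,
`Y` classical register of the error syndrome. -/

/-- The joint system `E` of reference, system, ancilla, hot bath and cold bath. -/
abbrev Total (R S A B C : Type*) := ((R × S × A) × B) × (A × C)

/-- The data of an error-correcting engine. -/
structure Engine (R S A B C M Y : Type*)
    [Fintype R] [Fintype S] [Fintype A] [Fintype B] [Fintype C] [Fintype M] [Fintype Y]
    [DecidableEq R] [DecidableEq S] [DecidableEq A] [DecidableEq B] [DecidableEq C]
    [DecidableEq M] [DecidableEq Y] where
  /-- Boltzmann's constant and the temperatures of hot bath, cold bath and apparatus. -/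
  kB : ℝ
  Th : ℝ
  Tc : ℝ
  Tm : ℝ
  kB_pos : 0 < kB
  Tc_pos : 0 < Tc
  Tm_pos : 0 < Tm
  Tc_le_Th : Tc ≤ Th
  /-- The pure initial state of `RS`. -/
  ψ : R × S → ℂ
  ψ_norm : ∑ i, ‖ψ i‖ ^ 2 = 1
  /-- Hamiltonian of `S` and energy levels of `A` (in its energy eigenbasis); these are the
  Hamiltonians at the beginning and at the end of the cycle, where `S` and `A` do not interact. -/
  HS : Matrix S S ℂ
  HS_herm : HS.IsHermitian
  energyA : A → ℝ
  /-- Hamiltonian of `SA` from the end of the encoding to the end of the syndrome measurement. -/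
  HSA : Matrix (S × A) (S × A) ℂ
  HSA_herm : HSA.IsHermitian
  HB : Matrix B B ℂ
  HB_herm : HB.IsHermitian
  /-- Hamiltonian of the part of the cold bath that is not swapped. -/
  HC : Matrix C C ℂ
  HC_herm : HC.IsHermitian
  HM : Matrix M M ℂ
  HM_herm : HM.IsHermitian
  /-- Energies of the pointer states of `Y`; the register starts in, and is erased to, the
  pointer state `y₀`, its ground state. -/
  energyY : Y → ℝ
  y₀ : Y
  ground : ∀ y, energyY y₀ ≤ energyY y
  /-- Encoding unitaries. -/
  Uenc : A → Matrix.unitaryGroup (S × A) ℂ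
  /-- The noise is a thermal operation. -/
  Uh : Matrix.unitaryGroup ((S × A) × B) ℂ
  Uh_comm : Commute (Uh : Matrix ((S × A) × B) ((S × A) × B) ℂ)
    (HSA ⊗ₖ (1 : Matrix B B ℂ) + (1 : Matrix (S × A) (S × A) ℂ) ⊗ₖ HB)
  /-- Indirect measurement model of the syndrome measurement, given `x`: an interaction with the
  apparatus followed by a projective measurement of the apparatus. -/
  Umeas : A → Matrix.unitaryGroup ((S × A) × M) ℂ
  P : A → Y → Matrix M M ℂ
  P_herm : ∀ x y, (P x y).IsHermitian
  P_mul : ∀ x y y', P x y * P x y' = if y = y' then P x y else 0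
  P_sum : ∀ x, ∑ y, P x y = 1
  /-- Decoding unitaries. -/
  Udec : A → Y → Matrix.unitaryGroup (S × A) ℂ

namespace Engine

section

variable {R S A B C M Y : Type*}

/-! Decompositions of composite systems into a subsystem and the rest. -/

def splitRSA : R × S × A ≃ (S × A) × R where
  toFun i := ((i.2.1, i.2.2), i.1)
  invFun j := (j.2, j.1.1, j.1.2)
  left_inv _ := rfl
  right_inv _ := rfl

def splitRSAB : (R × S × A) × B ≃ ((S × A) × B) × R where
  toFun i := (((i.1.2.1, i.1.2.2), i.2), i.1.1)
  invFun j := ((j.2, j.1.1.1, j.1.1.2), j.1.2)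
  left_inv _ := rfl
  right_inv _ := rfl

def splitSA : Total R S A B C ≃ (S × A) × (R × B × A × C) where
  toFun i := ((i.1.1.2.1, i.1.1.2.2), (i.1.1.1, i.1.2, i.2.1, i.2.2))
  invFun j := (((j.2.1, j.1.1, j.1.2), j.2.2.1), (j.2.2.2.1, j.2.2.2.2))
  left_inv _ := rfl
  right_inv _ := rfl

def splitSAM : Total R S A B C × M ≃ ((S × A) × M) × (R × B × A × C) where
  toFun i := (((splitSA i.1).1, i.2), (splitSA i.1).2)
  invFun j := (splitSA.symm (j.1.1, j.2), j.1.2)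
  left_inv _ := rfl
  right_inv _ := rfl

def splitRS : Total R S A B C ≃ (R × S) × (A × B × A × C) where
  toFun i := ((i.1.1.1, i.1.1.2.1), (i.1.1.2.2, i.1.2, i.2.1, i.2.2))
  invFun j := (((j.1.1, j.1.2, j.2.1), j.2.2.1), (j.2.2.2.1, j.2.2.2.2))
  left_inv _ := rfl
  right_inv _ := rfl

def splitHot : Total R S A B C ≃ B × ((R × S × A) × (A × C)) where
  toFun i := (i.1.2, (i.1.1, i.2))
  invFun j := ((j.2.1, j.1), j.2.2)
  left_inv _ := rfl
  right_inv _ := rfl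

def splitCold : Total R S A B C ≃ (A × C) × ((R × S × A) × B) := Equiv.prodComm _ _

/-- From `EXY` (with `(x, y) : A × Y`) to `EX` and `Y`. -/
def splitEX {E : Type*} : E × (A × Y) ≃ (E × A) × Y := (Equiv.prodAssoc _ _ _).symm

/-- From `EXY` to `RSA XY` and the baths. -/
def splitRSAXY : Total R S A B C × (A × Y) ≃ ((R × S × A) × (A × Y)) × (B × (A × C)) where
  toFun i := ((i.1.1.1, i.2), (i.1.1.2, i.1.2))
  invFun j := (((j.1.1, j.2.1), j.2.2), j.1.2)
  left_inv _ := rfl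
  right_inv _ := rfl

/-- From `EMYX` to `RSA M Y X` and the baths. -/
def splitRSAMYX : ((Total R S A B C × M) × Y) × A ≃
    ((R × S × A) × M × Y × A) × (B × (A × C)) where
  toFun i := ((i.1.1.1.1.1, i.1.1.2, i.1.2, i.2), (i.1.1.1.1.2, i.1.1.1.2))
  invFun j := (((((j.1.1, j.2.1), j.2.2), j.1.2.1), j.1.2.2.1), j.1.2.2.2)
  left_inv _ := rfl
  right_inv _ := rfl

/-- Exchange of the ancilla with its copy in the cold bath. -/
def swapA : Total R S A B C ≃ Total R S A B C where
  toFun i := (((i.1.1.1, i.1.1.2.1, i.2.1), i.1.2), (i.1.1.2.2, i.2.2))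
  invFun i := (((i.1.1.1, i.1.1.2.1, i.2.1), i.1.2), (i.1.1.2.2, i.2.2))
  left_inv _ := rfl
  right_inv _ := rfl

end

section

variable {R S A B C M Y : Type*}
    [Fintype R] [Fintype S] [Fintype A] [Fintype B] [Fintype C] [Fintype M] [Fintype Y]
    [DecidableEq R] [DecidableEq S] [DecidableEq A] [DecidableEq B] [DecidableEq C]
    [DecidableEq M] [DecidableEq Y]
    (𝓔 : Engine R S A B C M Y)

/-! #### Thermal states -/

/-- The Gibbs distribution of the ancilla, which is the distribution of `X`. -/
def pX (x : A) : ℝ :=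
  Real.exp (-𝓔.energyA x / (𝓔.kB * 𝓔.Tc)) / ∑ x', Real.exp (-𝓔.energyA x' / (𝓔.kB * 𝓔.Tc))

def τA : Matrix A A ℂ := Matrix.diagonal fun x => (𝓔.pX x : ℂ)

def τHot : Matrix B B ℂ := thermal (𝓔.kB * 𝓔.Th) 𝓔.HB

/-- The cold bath: a copy of the ancilla and the remaining bath, both thermal. -/
def τCold : Matrix (A × C) (A × C) ℂ := 𝓔.τA ⊗ₖ thermal (𝓔.kB * 𝓔.Tc) 𝓔.HC

def τM : Matrix M M ℂ := thermal (𝓔.kB * 𝓔.Tm) 𝓔.HM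

/-! #### Hamiltonians -/

def HA : Matrix A A ℂ := Matrix.diagonal fun x => (𝓔.energyA x : ℂ)

/-- The Hamiltonian of `SA` at the beginning and at the end of the cycle. -/
def HSAfree : Matrix (S × A) (S × A) ℂ :=
  𝓔.HS ⊗ₖ (1 : Matrix A A ℂ) + (1 : Matrix S S ℂ) ⊗ₖ 𝓔.HA

def HCold : Matrix (A × C) (A × C) ℂ :=
  𝓔.HA ⊗ₖ (1 : Matrix C C ℂ) + (1 : Matrix A A ℂ) ⊗ₖ 𝓔.HC

/-! #### The stages of the cycle -/

/-- `|ψ⟩⟨ψ| ⊗ |x⟩⟨x|` on `RSA`, after the initial measurement of the ancilla. -/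
def σ0 (x : A) : Matrix (R × S × A) (R × S × A) ℂ :=
  pureState fun i => 𝓔.ψ (i.1, i.2.1) * if i.2.2 = x then 1 else 0

/-- Encoded state of `RSA`. -/
def σenc (x : A) : Matrix (R × S × A) (R × S × A) ℂ :=
  evolve (extend splitRSA (𝓔.Uenc x : Matrix (S × A) (S × A) ℂ)) (𝓔.σ0 x)

/-- State of `E` after the noise, given `x`. -/
def σ1 (x : A) : Matrix (Total R S A B C) (Total R S A B C) ℂ :=
  evolve (extend splitRSAB (𝓔.Uh : Matrix ((S × A) × B) ((S × A) × B) ℂ)) (𝓔.σenc x ⊗ₖ 𝓔.τHot)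
    ⊗ₖ 𝓔.τCold

/-- The joint state of `E` and the apparatus after their interaction, for the input `ρ`. -/
def interact (x : A) (ρ : Matrix (Total R S A B C) (Total R S A B C) ℂ) :
    Matrix (Total R S A B C × M) (Total R S A B C × M) ℂ :=
  evolve (extend splitSAM (𝓔.Umeas x : Matrix ((S × A) × M) ((S × A) × M) ℂ)) (ρ ⊗ₖ 𝓔.τM)

/-- The map of the quantum instrument with outcome `y`, given `x`
(acting on `SA` and trivially on the rest of `E`). -/
def instr (x : A) (y : Y) (ρ : Matrix (Total R S A B C) (Total R S A B C) ℂ) :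
    Matrix (Total R S A B C) (Total R S A B C) ℂ :=
  reduce (Equiv.refl _) (𝓔.interact x ρ *
    ((1 : Matrix (Total R S A B C) (Total R S A B C) ℂ) ⊗ₖ 𝓔.P x y))

/-- The instrument given `x` as a map `ρ ↦ ∑ y, N_{y|x}(ρ) ⊗ |y⟩⟨y|`. -/
def instrument (x : A) (ρ : Matrix (Total R S A B C) (Total R S A B C) ℂ) :
    Matrix (Total R S A B C × Y) (Total R S A B C × Y) ℂ :=
  Matrix.blockDiagonal fun y => 𝓔.instr x y ρ

/-- State of `EXY` before the syndrome measurement. -/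
def σ1EXY : Matrix (Total R S A B C × (A × Y)) (Total R S A B C × (A × Y)) ℂ :=
  Matrix.blockDiagonal fun z => if z.2 = 𝓔.y₀ then (𝓔.pX z.1 : ℂ) • 𝓔.σ1 z.1 else 0

/-- State of `EXY` after the syndrome measurement (the weight `p(y|x)` is the trace of the
unnormalised state `N_{y|x}(σ1 x)`). -/
def σ2EXY : Matrix (Total R S A B C × (A × Y)) (Total R S A B C × (A × Y)) ℂ :=
  Matrix.blockDiagonal fun z => (𝓔.pX z.1 : ℂ) • 𝓔.instr z.1 z.2 (𝓔.σ1 z.1)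

/-- State of `EMY` after the syndrome measurement, given `x`, including the apparatus: the
controlled unitary `∑ y, P_y ⊗ V_y` with `V_y |y₀⟩ = |y⟩` writes the outcome into `Y`, so that
the state is `∑ y y', P_y ω P_y' ⊗ |y⟩⟨y'|`. -/
def σ2EMY (x : A) : Matrix ((Total R S A B C × M) × Y) ((Total R S A B C × M) × Y) ℂ :=
  Matrix.of fun i j =>
    (((1 : Matrix (Total R S A B C) (Total R S A B C) ℂ) ⊗ₖ 𝓔.P x i.2) * 𝓔.interact x (𝓔.σ1 x) *
      ((1 : Matrix (Total R S A B C) (Total R S A B C) ℂ) ⊗ₖ 𝓔.P x j.2)) i.1 j.1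

def σ2EMYX : Matrix (((Total R S A B C × M) × Y) × A) (((Total R S A B C × M) × Y) × A) ℂ :=
  Matrix.blockDiagonal fun x => (𝓔.pX x : ℂ) • 𝓔.σ2EMY x

def σ2RSAMYX : Matrix ((R × S × A) × M × Y × A) ((R × S × A) × M × Y × A) ℂ :=
  reduce splitRSAMYX 𝓔.σ2EMYX

/-- State of `EXY` after the error correction. -/
def σ3EXY : Matrix (Total R S A B C × (A × Y)) (Total R S A B C × (A × Y)) ℂ :=
  Matrix.blockDiagonal fun z =>
    evolve (extend splitSA (𝓔.Udec z.1 z.2 : Matrix (S × A) (S × A) ℂ))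
      ((𝓔.pX z.1 : ℂ) • 𝓔.instr z.1 z.2 (𝓔.σ1 z.1))

/-- State of `EXY` after the resetting of the ancilla. -/
def σfEXY : Matrix (Total R S A B C × (A × Y)) (Total R S A B C × (A × Y)) ℂ :=
  𝓔.σ3EXY.submatrix (Prod.map swapA id) (Prod.map swapA id)

def σfEX : Matrix (Total R S A B C × A) (Total R S A B C × A) ℂ := reduce splitEX 𝓔.σfEXY

/-- Final state of `E`, after the registers are discarded. -/
def σfE : Matrix (Total R S A B C) (Total R S A B C) ℂ := reduce (Equiv.refl _) 𝓔.σfEXY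

def σfRS : Matrix (R × S) (R × S) ℂ := reduce splitRS 𝓔.σfE

/-! #### Information quantities -/

/-- Entanglement fidelity `⟨ψ|σ_f^{RS}|ψ⟩`. -/
def fidelity : ℝ := (star 𝓔.ψ ⬝ᵥ (𝓔.σfRS.mulVec 𝓔.ψ)).re

/-- Entropy exchange `H(RS)` of the final state. -/
def entropyExchange : ℝ := entropy 𝓔.σfRS

/-- Maximal entanglement fidelity allowed by the quantum Fano inequality at the entropy exchange
of the engine, with `d = dim (H_S ⊗ H_R)`. -/
def maxFidelity : ℝ := fanoMaximum (Fintype.card S * Fintype.card R) 𝓔.entropyExchange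

/-- Efficacy of the syndrome instrument, given `x`, with respect to `σ1 x`. -/
def instrumentEfficacy (x : A) : ℝ := efficacy (𝓔.instrument x) (𝓔.σ1 x)

/-- `H(X|E)` of the final state. -/
def condX_E : ℝ := entropy 𝓔.σfEX - entropy 𝓔.σfE

/-- `H(Y|EX)` of the final state. -/
def condY_EX : ℝ := entropy 𝓔.σfEXY - entropy 𝓔.σfEX

/-- The state of `XY` after the syndrome measurement. -/
def σ2XY : Matrix (A × Y) (A × Y) ℂ := reduce (Equiv.prodComm _ _) 𝓔.σ2EXY

/-- `H(Y|X)` after the syndrome measurement. -/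
def condY_X : ℝ := entropy 𝓔.σ2XY - entropy (reduce (Equiv.refl _) 𝓔.σ2XY)

def σ2MYX : Matrix (M × Y × A) (M × Y × A) ℂ := reduce (Equiv.prodComm _ _) 𝓔.σ2RSAMYX

/-- `I(Y:M|X) = H(YX) + H(MX) - H(MYX) - H(X)` after the syndrome measurement. -/
def mutualYM_X : ℝ :=
  entropy 𝓔.σ2XY
    + entropy (reduce ((Equiv.prodCongrRight fun _ => Equiv.prodComm Y A).trans
        (Equiv.prodAssoc M A Y).symm) 𝓔.σ2MYX)
    - entropy 𝓔.σ2MYX - entropy (reduce (Equiv.refl _) 𝓔.σ2XY)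

/-- `I(RSA:M|XY) = H(RSA XY) + H(M XY) - H(RSA M XY) - H(XY)` after the syndrome measurement. -/
def mutualRSAM_XY : ℝ :=
  entropy (reduce splitRSAXY 𝓔.σ2EXY) + entropy 𝓔.σ2MYX - entropy 𝓔.σ2RSAMYX - entropy 𝓔.σ2XY

/-- `H(RSA|XY)` for a state of `EXY`. -/
def condRSA_XY (σ : Matrix (Total R S A B C × (A × Y)) (Total R S A B C × (A × Y)) ℂ) : ℝ :=
  entropy (reduce splitRSAXY σ) - entropy (reduce (Equiv.prodComm _ _) σ)

/-! #### Heat, energy, work -/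

/-- Heat absorbed by `SA` from the hot bath. -/
def Qh : ℝ := expectation 𝓔.HB 𝓔.τHot - expectation 𝓔.HB (reduce splitHot 𝓔.σfE)

/-- Heat absorbed by `SA` from the cold bath. -/
def Qc : ℝ := expectation 𝓔.HCold 𝓔.τCold - expectation 𝓔.HCold (reduce splitCold 𝓔.σfE)

/-- Heat absorbed from the measurement apparatus. -/
def Qmeas : ℝ :=
  expectation 𝓔.HM 𝓔.τM - expectation 𝓔.HM (reduce (Equiv.refl _) 𝓔.σ2MYX)

/-- Measurement heat of the register, `k_B T_m (ΔH(Y|X) - I(Y:M|X))`, where `Y` is initially pure. -/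
def QmeasY : ℝ := 𝓔.kB * 𝓔.Tm * (𝓔.condY_X - 𝓔.mutualYM_X)

/-- Measurement heat of `RSA` given the register, `k_B T_m (ΔH(RSA|XY) - I(RSA:M|XY))`. -/
def QmeasRSA : ℝ :=
  𝓔.kB * 𝓔.Tm * (condRSA_XY 𝓔.σ2EXY - condRSA_XY 𝓔.σ1EXY - 𝓔.mutualRSAM_XY)

/-- Mean energy of `Y` in a state of `EXY`. -/
def meanY (σ : Matrix (Total R S A B C × (A × Y)) (Total R S A B C × (A × Y)) ℂ) : ℝ :=
  expectation (Matrix.diagonal fun z : A × Y => (𝓔.energyY z.2 : ℂ))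
    (reduce (Equiv.prodComm _ _) σ)

/-- Erasure heat `⟨H_Y⟩_i - ⟨H_Y⟩_f`. -/
def Qerase : ℝ := 𝓔.energyY 𝓔.y₀ - 𝓔.meanY 𝓔.σfEXY

/-- `SA` part of a state of `EXY`. -/
def partSA (σ : Matrix (Total R S A B C × (A × Y)) (Total R S A B C × (A × Y)) ℂ) :
    Matrix (S × A) (S × A) ℂ :=
  reduce splitSA (reduce (Equiv.refl _) σ)

/-! Internal energies of `RSAY` (the Hamiltonian of `R` is zero). -/

def Ui : ℝ :=
  expectation 𝓔.HSAfree (reduce (Equiv.prodComm R S) (pureState 𝓔.ψ) ⊗ₖ 𝓔.τA) + 𝓔.energyY 𝓔.y₀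

def U0 : ℝ :=
  ∑ x, 𝓔.pX x * expectation 𝓔.HSAfree (reduce splitRSA (𝓔.σ0 x)) + 𝓔.energyY 𝓔.y₀

def Uencoded : ℝ :=
  ∑ x, 𝓔.pX x * expectation 𝓔.HSA (reduce splitRSA (𝓔.σenc x)) + 𝓔.energyY 𝓔.y₀

def U1 : ℝ := expectation 𝓔.HSA (partSA 𝓔.σ1EXY) + 𝓔.meanY 𝓔.σ1EXY

def U2 : ℝ := expectation 𝓔.HSA (partSA 𝓔.σ2EXY) + 𝓔.meanY 𝓔.σ2EXY

def U3 : ℝ := expectation 𝓔.HSAfree (partSA 𝓔.σ3EXY) + 𝓔.meanY 𝓔.σ3EXY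

/-- After the erasure of `Y`. -/
def Uerase : ℝ := expectation 𝓔.HSAfree (partSA 𝓔.σfEXY) + 𝓔.energyY 𝓔.y₀

/-- Net change of the internal energy over the cycle. -/
def ΔU : ℝ := 𝓔.Uerase - 𝓔.Ui

def Wenc : ℝ := 𝓔.Uencoded - 𝓔.U0

def Wmeas : ℝ := 𝓔.U2 - 𝓔.U1 - 𝓔.Qmeas

def Wdec : ℝ := 𝓔.U3 - 𝓔.U2

def Wtot : ℝ := 𝓔.Wenc + 𝓔.Wmeas + 𝓔.Wdec

def Qinput : ℝ := 𝓔.Qh + 𝓔.QmeasY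

/-- Thermodynamic efficiency. -/
def efficiency : ℝ := -𝓔.Wtot / 𝓔.Qinput

def carnot : ℝ := 1 - 𝓔.Tc / 𝓔.Th

/-! #### Standing regime and the four physical assumptions

The relations `≪` and `≈` are read with a relative tolerance `ε`. -/

/-- The heat-engine regime. -/
structure HeatEngineRegime : Prop where
  Qh_nonneg : 0 ≤ 𝓔.Qh
  Qc_nonpos : 𝓔.Qc ≤ 0
  QmeasRSA_nonpos : 𝓔.QmeasRSA ≤ 0
  Qinput_pos : 0 < 𝓔.Qinput

/-- The net change of internal energy is negligible: `|ΔU| ≪ Q_input`. -/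
def NegligibleEnergyChange (ε : ℝ) : Prop := |𝓔.ΔU| ≤ ε * 𝓔.Qinput

/-- The entropy of `X` is negligible: `H(X|E) ≪ H(Y|EX)` in the final state. -/
def NegligibleMemoryX (ε : ℝ) : Prop := 𝓔.condX_E ≤ ε * 𝓔.condY_EX

/-- Landauer's bound is reached: `|Q_erase| ≈ k_B T_c H(Y|X)`. -/
def LandauerReached (ε : ℝ) : Prop :=
  |(|𝓔.Qerase|) - 𝓔.kB * 𝓔.Tc * 𝓔.condY_X| ≤ ε * (𝓔.kB * 𝓔.Tc * 𝓔.condY_X)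

/-- The measurement dissipates enough heat. -/
def SufficientMeasurementHeat : Prop := 𝓔.Tc / 𝓔.Th * 𝓔.QmeasY ≤ |𝓔.QmeasRSA|

end

end Engine

end QECEngine

end

/-! The theorem combines an entropy balance (second law) with an energy balance (first law).

Entropy. Before the syndrome measurement the only entropy is that of the thermal inputs: `RSA` is
pure given `x`, and `X` has the Gibbs distribution of the ancilla. Efficacy at most one prevents the
measurement from lowering the entropy (`entropy_le_of_efficacy_le_one`), and correction and swap are
unitary, so the final H(EXY) is at least H(τA) + H(τHot) + H(τCold). The chain rule gives H(EXY) =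
H(E) + H(X|E) + H(Y|EX), and subadditivity bounds H(E) by S_e + H(τA) plus the final entropies of
the two baths. Gibbs states minimise free energy (`IsGibbs.variational`), so Q/θ is at most the
entropy drop of each bath. The outcome is `clausius`: Q_h/(k_B T_h) + Q_c/(k_B T_c) ≤ S_e + H(X|E) +
H(Y|EX).

Fidelity. If the maximal fidelity is 1, the Fano bound at F = 1 forces S_e ≤ 0
(`nonpos_of_fanoMaximum_eq_one`). As H(Y|EX) ≤ H(Y|X) (`condY_EX_le`), with t = T_c/T_h and k = k_B
T_c H(Y|X) one gets t Q_h + Q_c ≤ (1 + ε) k.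

Energy. The first law reads -W = Q_meas + Q_h + Q_c + Q_erase - ΔU (`neg_Wtot_eq`). Here Q_meas is
at most the sum of the measurement heats of `Y` and `RSA` (`Qmeas_le`), the latter being at most -t
times the former by assumption, and Q_erase ≤ -(1 - ε) k. The terms in k almost cancel: -W ≤ (1 - t)
Q_input + ε Q_input + 2εk. The signs in the heat-engine regime bound k by (1 + ε)/(1 - ε) Q_input
whenever -W ≥ 0, which yields δ(ε). -/

noncomputable section

namespace QECEngine

open Matrix Real
open scoped ComplexOrder

set_option linter.unusedSectionVars false

/-! ### Entropy as a function of the spectrum, for states of arbitrary trace. -/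

section Entropy

variable {I J : Type*} [Fintype I] [DecidableEq I] [Fintype J] [DecidableEq J]

/-- A Hermitian matrix in terms of its eigenvalues. -/
theorem exists_unitary_diagonal {ρ : Matrix I I ℂ} (h : ρ.IsHermitian) :
    ∃ (U : Matrix I I ℂ) (d : I → ℝ), Uᴴ * U = 1 ∧ U * Uᴴ = 1 ∧
      ρ = U * diagonal (fun i => (d i : ℂ)) * Uᴴ ∧ d = h.eigenvalues ∧
      ∀ f : ℝ → ℝ, cfc f ρ = U * diagonal (fun i => (f (d i) : ℂ)) * Uᴴ := by
  refine ⟨h.eigenvectorUnitary, h.eigenvalues, ?_, ?_, ?_, rfl, fun f => ?_⟩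
  · exact Unitary.coe_star_mul_self h.eigenvectorUnitary
  · exact Unitary.coe_mul_star_self h.eigenvectorUnitary
  · conv_lhs => rw [h.spectral_theorem]
    rfl
  · rw [h.cfc_eq]; rfl

theorem entropy_eq_sum_eigenvalues {ρ : Matrix I I ℂ} (h : ρ.IsHermitian) :
    entropy ρ = ∑ i, negMulLog (h.eigenvalues i) := by
  obtain ⟨U, d, hU, -, hρ, hd, hc⟩ := exists_unitary_diagonal h
  rw [entropy, hc, ← hd]
  conv_lhs => rw [hρ]
  have : U * diagonal (fun i => (d i : ℂ)) * Uᴴ * (U * diagonal (fun i => (log (d i) : ℂ)) * Uᴴ)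
      = U * (diagonal (fun i => (d i : ℂ)) * diagonal (fun i => (log (d i) : ℂ))) * Uᴴ := by
    simp only [Matrix.mul_assoc]
    rw [← Matrix.mul_assoc Uᴴ U, hU, Matrix.one_mul]
  rw [this, Matrix.trace_mul_comm, ← Matrix.mul_assoc, hU, Matrix.one_mul, diagonal_mul_diagonal,
    trace_diagonal]
  simp [negMulLog, ← Complex.ofReal_mul]

/-- Roots of the characteristic polynomial carry no choice of eigenbasis or ordering, so invariance
of the entropy reduces to identities between characteristic polynomials. -/
theorem entropy_eq_sum_roots {ρ : Matrix I I ℂ} (h : ρ.IsHermitian) :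
    entropy ρ = (ρ.charpoly.roots.map fun z => negMulLog z.re).sum := by
  rw [entropy_eq_sum_eigenvalues h, h.roots_charpoly_eq_eigenvalues]
  simp

theorem entropy_submatrix (e : J ≃ I) {ρ : Matrix I I ℂ} (h : ρ.IsHermitian) :
    entropy (ρ.submatrix e e) = entropy ρ := by
  rw [entropy_eq_sum_roots h, entropy_eq_sum_roots (h.submatrix e),
    show ρ.submatrix e e = reindex e.symm e.symm ρ from rfl, charpoly_reindex]

theorem entropy_isometry {W : Matrix J I ℂ} (hW : Wᴴ * W = 1) {ρ : Matrix I I ℂ}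
    (h : ρ.IsHermitian) : entropy (W * ρ * Wᴴ) = entropy ρ := by
  have h' : (W * ρ * Wᴴ).IsHermitian := isHermitian_mul_mul_conjTranspose W h
  -- Products in the two orders have the same characteristic polynomial up to powers of `X`. The
  -- extra roots are 0 and contribute nothing, because `negMulLog 0 = 0`; hence `W` need not be
  -- square.
  have key := charpoly_mul_comm' (W * ρ) Wᴴ
  rw [← Matrix.mul_assoc Wᴴ, hW, Matrix.one_mul] at key
  have := congrArg (fun p : Polynomial ℂ => (p.roots.map fun z => negMulLog z.re).sum) key
  beta_reduce at this
  rw [Polynomial.roots_mul (mul_ne_zero (pow_ne_zero _ Polynomial.X_ne_zero)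
      (charpoly_monic _).ne_zero),
    Polynomial.roots_mul (mul_ne_zero (pow_ne_zero _ Polynomial.X_ne_zero)
      (charpoly_monic _).ne_zero)] at this
  simpa [entropy_eq_sum_roots h, entropy_eq_sum_roots h', Multiset.map_nsmul, Multiset.sum_nsmul] using this

theorem entropy_evolve {V : Matrix I I ℂ} (hV : Vᴴ * V = 1) {ρ : Matrix I I ℂ}
    (h : ρ.IsHermitian) : entropy (evolve V ρ) = entropy ρ := entropy_isometry hV h

theorem isHermitian_diagonal_ofReal (d : I → ℝ) :
    (diagonal fun i => (d i : ℂ)).IsHermitian := by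
  rw [IsHermitian, diagonal_conjTranspose]
  congr 1; ext i; simp

theorem entropy_diagonal (d : I → ℝ) :
    entropy (diagonal fun i => (d i : ℂ)) = ∑ i, negMulLog (d i) := by
  rw [entropy_eq_sum_roots (isHermitian_diagonal_ofReal d), charpoly_diagonal,
    Polynomial.roots_prod _ _ (Finset.prod_ne_zero_iff.2 fun i _ => Polynomial.X_sub_C_ne_zero _)]
  simp

theorem entropy_zero : entropy (0 : Matrix I I ℂ) = 0 := by
  simp [entropy]

theorem entropy_unitary_diagonal {U : Matrix J I ℂ} (hU : Uᴴ * U = 1) (d : I → ℝ) :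
    entropy (U * diagonal (fun i => (d i : ℂ)) * Uᴴ) = ∑ i, negMulLog (d i) := by
  rw [entropy_isometry hU (isHermitian_diagonal_ofReal d), entropy_diagonal]

/-- Spectral decomposition of a positive semidefinite matrix. -/
theorem exists_spectral {ρ : Matrix I I ℂ} (h : ρ.PosSemidef) :
    ∃ (U : Matrix I I ℂ) (d : I → ℝ), Uᴴ * U = 1 ∧ U * Uᴴ = 1 ∧
      ρ = U * diagonal (fun i => (d i : ℂ)) * Uᴴ ∧ (∀ i, 0 ≤ d i) ∧
      (∑ i, d i = ρ.trace.re) ∧ entropy ρ = ∑ i, negMulLog (d i) := by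
  obtain ⟨U, d, h1, h2, h3, h4, -⟩ := exists_unitary_diagonal h.isHermitian
  refine ⟨U, d, h1, h2, h3, fun i => ?_, ?_, ?_⟩
  · rw [h4]; exact h.eigenvalues_nonneg i
  · rw [h3, Matrix.trace_mul_comm, ← Matrix.mul_assoc, h1, Matrix.one_mul, trace_diagonal]
    simp
  · rw [h4, entropy_eq_sum_eigenvalues h.isHermitian]

/-- Branches labelled by classical outcomes are kept unnormalised, with their probability as trace;
this rule extracts the weights. -/
theorem entropy_smul {ρ : Matrix I I ℂ} (h : ρ.PosSemidef) (c : ℝ) :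
    entropy ((c : ℂ) • ρ) = c * entropy ρ + negMulLog c * ρ.trace.re := by
  obtain ⟨U, d, h1, -, h3, -, h5, h6⟩ := exists_spectral h
  rw [h6, ← h5]
  have : (c : ℂ) • ρ = U * diagonal (fun i => ((c * d i : ℝ) : ℂ)) * Uᴴ := by
    rw [h3, ← Matrix.smul_mul, ← Matrix.mul_smul, ← diagonal_smul]
    congr 3; ext i; simp
  rw [this, entropy_unitary_diagonal h1, Finset.mul_sum, Finset.mul_sum, ← Finset.sum_add_distrib]
  exact Finset.sum_congr rfl fun i _ => by rw [negMulLog_mul]; ring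

theorem entropy_kronecker {ρ : Matrix I I ℂ} {σ : Matrix J J ℂ} (hρ : ρ.PosSemidef)
    (hσ : σ.PosSemidef) :
    entropy (ρ ⊗ₖ σ) = σ.trace.re * entropy ρ + ρ.trace.re * entropy σ := by
  obtain ⟨U, d, hU, -, h3, -, h5, h6⟩ := exists_spectral hρ
  obtain ⟨V, c, hV, -, k3, -, k5, k6⟩ := exists_spectral hσ
  have : ρ ⊗ₖ σ = (U ⊗ₖ V) * diagonal (fun i : I × J => ((d i.1 * c i.2 : ℝ) : ℂ)) *
      (U ⊗ₖ V)ᴴ := by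
    rw [conjTranspose_kronecker, h3, k3, mul_kronecker_mul, mul_kronecker_mul,
      diagonal_kronecker_diagonal]
    simp
  rw [this, entropy_unitary_diagonal (by rw [conjTranspose_kronecker, ← mul_kronecker_mul, hU, hV,
    one_kronecker_one]), h6, k6, ← h5, ← k5, Fintype.sum_prod_type, Finset.sum_mul_sum,
    Finset.sum_mul_sum, Finset.sum_comm (γ := J), ← Finset.sum_add_distrib]
  refine Finset.sum_congr rfl fun i _ => ?_
  rw [← Finset.sum_add_distrib]
  exact Finset.sum_congr rfl fun j _ => by rw [negMulLog_mul]

theorem charpoly_blockDiagonal (M : J → Matrix I I ℂ) :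
    (blockDiagonal M).charpoly = ∏ j, (M j).charpoly := by
  simp only [charpoly]
  rw [← det_blockDiagonal]
  congr 1
  ext ⟨i, k⟩ ⟨i', k'⟩
  by_cases h : k = k' <;> by_cases h' : i = i' <;>
    simp [blockDiagonal_apply, h, h']

theorem isHermitian_blockDiagonal {M : J → Matrix I I ℂ} (h : ∀ j, (M j).IsHermitian) :
    (blockDiagonal M).IsHermitian := by
  rw [IsHermitian, blockDiagonal_conjTranspose]
  congr 1; ext1 j; exact h j

/-- The spectrum is the union of the spectra of the blocks. No separate Shannon term appears, since
the blocks already contain the probabilities. -/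
theorem entropy_blockDiagonal {M : J → Matrix I I ℂ} (h : ∀ j, (M j).IsHermitian) :
    entropy (blockDiagonal M) = ∑ j, entropy (M j) := by
  rw [entropy_eq_sum_roots (isHermitian_blockDiagonal h), charpoly_blockDiagonal,
    Polynomial.roots_prod _ _ (Finset.prod_ne_zero_iff.2 fun i _ => (charpoly_monic _).ne_zero)]
  simp only [entropy_eq_sum_roots (h _), Multiset.map_bind, Multiset.sum_bind]
  rfl

end Entropy

/-! ### Partial traces, local operators and conserved observables. -/

section PartialTrace

variable {I K L : Type*} [Fintype I] [DecidableEq I] [Fintype K] [DecidableEq K]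
  [Fintype L] [DecidableEq L]

theorem extend_apply (e : I ≃ K × L) (T : Matrix K K ℂ) (i j : I) :
    extend e T i j = if (e i).2 = (e j).2 then T (e i).1 (e j).1 else 0 := by
  simp [extend, one_apply]

theorem reduce_extend_mul (e : I ≃ K × L) (T : Matrix K K ℂ) (ρ : Matrix I I ℂ) :
    reduce e (extend e T * ρ) = T * reduce e ρ := by
  ext k k'
  simp only [reduce, of_apply, mul_apply, Finset.mul_sum]
  rw [Finset.sum_comm]
  simp only [← e.symm.sum_comp, Fintype.sum_prod_type, extend_apply, Equiv.apply_symm_apply]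
  simp

theorem reduce_mul_extend (e : I ≃ K × L) (T : Matrix K K ℂ) (ρ : Matrix I I ℂ) :
    reduce e (ρ * extend e T) = reduce e ρ * T := by
  ext k k'
  simp only [reduce, of_apply, mul_apply, Finset.sum_mul]
  rw [Finset.sum_comm]
  simp only [← e.symm.sum_comp, Fintype.sum_prod_type, extend_apply, Equiv.apply_symm_apply]
  simp

/-- The equivalence onto the complementary subsystem. -/
abbrev compl (e : I ≃ K × L) : I ≃ L × K := e.trans (Equiv.prodComm K L)

/-- A partial trace is cyclic for operators that act only on the system traced out. No-signalling
(`reduce_compl_evolve`) and the symmetric form of the instrument (`instr_eq`) rest on this. -/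
theorem reduce_compl_extend_comm (e : I ≃ K × L) (T : Matrix K K ℂ) (ρ : Matrix I I ℂ) :
    reduce (compl e) (extend e T * ρ) = reduce (compl e) (ρ * extend e T) := by
  ext l l'
  simp only [reduce, of_apply, mul_apply]
  simp only [← e.symm.sum_comp, Fintype.sum_prod_type, extend_apply, compl, Equiv.symm_trans_apply,
    Equiv.prodComm_symm, Equiv.prodComm_apply, Prod.swap_prod_mk, Equiv.apply_symm_apply]
  simp only [ite_mul, zero_mul, mul_ite, mul_zero, Finset.sum_ite_eq, Finset.sum_ite_eq',
    Finset.mem_univ, if_true]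
  rw [Finset.sum_comm]
  simp only [mul_comm]

theorem extend_mul (e : I ≃ K × L) (S T : Matrix K K ℂ) :
    extend e (S * T) = extend e S * extend e T := by
  rw [extend, extend, extend, submatrix_mul_equiv, ← mul_kronecker_mul, Matrix.one_mul]

theorem extend_one (e : I ≃ K × L) : extend e (1 : Matrix K K ℂ) = 1 := by
  simp [extend]

theorem extend_conjTranspose (e : I ≃ K × L) (T : Matrix K K ℂ) :
    extend e Tᴴ = (extend e T)ᴴ := by
  simp [extend, conjTranspose_kronecker]

theorem extend_isometry (e : I ≃ K × L) {V : Matrix K K ℂ} (hV : Vᴴ * V = 1) :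
    (extend e V)ᴴ * extend e V = 1 := by
  rw [← extend_conjTranspose, ← extend_mul, hV, extend_one]

theorem reduce_evolve (e : I ≃ K × L) (V : Matrix K K ℂ) (ρ : Matrix I I ℂ) :
    reduce e (evolve (extend e V) ρ) = evolve V (reduce e ρ) := by
  rw [evolve, evolve, ← extend_conjTranspose, reduce_mul_extend, reduce_extend_mul]

theorem reduce_compl_evolve (e : I ≃ K × L) {V : Matrix K K ℂ} (hV : Vᴴ * V = 1)
    (ρ : Matrix I I ℂ) :
    reduce (compl e) (evolve (extend e V) ρ) = reduce (compl e) ρ := by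
  rw [evolve, Matrix.mul_assoc, reduce_compl_extend_comm, Matrix.mul_assoc,
    ← extend_conjTranspose, ← extend_mul, hV, extend_one, Matrix.mul_one]

theorem trace_reduce (e : I ≃ K × L) (ρ : Matrix I I ℂ) : (reduce e ρ).trace = ρ.trace := by
  simp only [trace, diag, reduce, of_apply]
  rw [← e.symm.sum_comp, Fintype.sum_prod_type]

theorem expectation_reduce (e : I ≃ K × L) (H : Matrix K K ℂ) (ρ : Matrix I I ℂ) :
    expectation H (reduce e ρ) = expectation (extend e H) ρ := by
  rw [expectation, expectation, ← reduce_mul_extend, trace_reduce]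

theorem posSemidef_reduce (e : I ≃ K × L) {ρ : Matrix I I ℂ} (h : ρ.PosSemidef) :
    (reduce e ρ).PosSemidef := by
  have : reduce e ρ = ∑ l, ρ.submatrix (fun k => e.symm (k, l)) (fun k => e.symm (k, l)) := by
    ext; simp [reduce, Matrix.sum_apply]
  rw [this]
  exact posSemidef_sum _ fun l _ => h.submatrix _

theorem posSemidef_evolve (V : Matrix I I ℂ) {ρ : Matrix I I ℂ} (h : ρ.PosSemidef) :
    (evolve V ρ).PosSemidef := h.mul_mul_conjTranspose_same V

theorem trace_evolve {V : Matrix I I ℂ} (hV : Vᴴ * V = 1) (ρ : Matrix I I ℂ) :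
    (evolve V ρ).trace = ρ.trace := by
  rw [evolve, Matrix.trace_mul_comm, ← Matrix.mul_assoc, hV, Matrix.one_mul]

theorem reduce_add (e : I ≃ K × L) (ρ σ : Matrix I I ℂ) :
    reduce e (ρ + σ) = reduce e ρ + reduce e σ := by
  ext; simp [reduce, Finset.sum_add_distrib]

theorem reduce_smul (e : I ≃ K × L) (c : ℂ) (ρ : Matrix I I ℂ) :
    reduce e (c • ρ) = c • reduce e ρ := by
  ext; simp [reduce, Finset.mul_sum]

theorem reduce_sum {ι : Type*} (s : Finset ι) (e : I ≃ K × L) (ρ : ι → Matrix I I ℂ) :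
    reduce e (∑ i ∈ s, ρ i) = ∑ i ∈ s, reduce e (ρ i) := by
  ext k k'
  simp only [reduce, of_apply, Matrix.sum_apply]
  rw [Finset.sum_comm]

theorem expectation_smul (H ρ : Matrix I I ℂ) (c : ℝ) :
    expectation H ((c : ℂ) • ρ) = c * expectation H ρ := by
  simp [expectation]

theorem expectation_sum {ι : Type*} (s : Finset ι) (H : Matrix I I ℂ) (ρ : ι → Matrix I I ℂ) :
    expectation H (∑ i ∈ s, ρ i) = ∑ i ∈ s, expectation H (ρ i) := by
  simp [expectation, Matrix.sum_mul, trace_sum]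

theorem expectation_add_left (H H' ρ : Matrix I I ℂ) :
    expectation (H + H') ρ = expectation H ρ + expectation H' ρ := by
  simp [expectation, Matrix.mul_add]

/-- Observables that commute with the evolution are conserved. -/
theorem expectation_evolve {V : Matrix I I ℂ} (hV : Vᴴ * V = 1) {H : Matrix I I ℂ}
    (h : V * H = H * V) (ρ : Matrix I I ℂ) : expectation H (evolve V ρ) = expectation H ρ := by
  have hV' : V * Vᴴ = 1 := mul_eq_one_comm.1 hV
  have h' : Vᴴ * H = H * Vᴴ := by
    calc Vᴴ * H = Vᴴ * (H * V) * Vᴴ := by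
          rw [Matrix.mul_assoc, Matrix.mul_assoc, hV', Matrix.mul_one]
      _ = H * Vᴴ := by rw [← h, ← Matrix.mul_assoc, hV, Matrix.one_mul]
  rw [expectation, expectation, evolve, Matrix.mul_assoc, h', ← Matrix.mul_assoc,
    Matrix.trace_mul_comm, ← Matrix.mul_assoc, ← Matrix.mul_assoc, hV, Matrix.one_mul]

end PartialTrace

/-! ### Classical Gibbs inequality and subadditivity. -/

section Classical

variable {I J : Type*} [Fintype I] [DecidableEq I] [Fintype J] [DecidableEq J]

/-- This is a log (b/a) ≤ b - a, from log z ≤ z - 1. All relative-entropy estimates below are sums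
of it. The support condition `h` is needed because `log 0 = 0` by convention. -/
theorem negMulLog_add_mul_log_le {a b : ℝ} (ha : 0 ≤ a) (hb : 0 ≤ b) (h : b = 0 → a = 0) :
    negMulLog a + a * log b ≤ b - a := by
  rcases ha.eq_or_lt with rfl | ha
  · simpa using hb
  have hb : 0 < b := lt_of_le_of_ne hb fun h' => ha.ne' (h h'.symm)
  have := log_le_sub_one_of_pos (div_pos hb ha)
  rw [log_div hb.ne' ha.ne'] at this
  have h2 := mul_le_mul_of_nonneg_left this ha.le
  have h3 : a * (b / a - 1) = b - a := by field_simp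
  rw [h3] at h2
  rw [negMulLog]; linarith

/-- Mutual information is non-negative. The term in the total mass makes the inequality homogeneous
and vanishes for probability distributions. -/
theorem sum_negMulLog_marginals {d : I → J → ℝ} (hd : ∀ i j, 0 ≤ d i j) :
    ∑ i, ∑ j, negMulLog (d i j) + negMulLog (∑ i, ∑ j, d i j) ≤
      ∑ i, negMulLog (∑ j, d i j) + ∑ j, negMulLog (∑ i, d i j) := by
  set T := ∑ i, ∑ j, d i j with hT
  set r : I → ℝ := fun i => ∑ j, d i j with hr
  set c : J → ℝ := fun j => ∑ i, d i j with hc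
  have hr0 : ∀ i, 0 ≤ r i := fun i => Finset.sum_nonneg fun j _ => hd i j
  have hc0 : ∀ j, 0 ≤ c j := fun j => Finset.sum_nonneg fun i _ => hd i j
  have hTr : ∑ i, r i = T := rfl
  have hTc : ∑ j, c j = T := Finset.sum_comm
  have hdr : ∀ i j, d i j ≤ r i := fun i j =>
    Finset.single_le_sum (f := fun j => d i j) (fun j _ => hd i j) (Finset.mem_univ j)
  have hdc : ∀ i j, d i j ≤ c j := fun i j =>
    Finset.single_le_sum (f := fun i => d i j) (fun i _ => hd i j) (Finset.mem_univ i)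
  have hrT : ∀ i, r i ≤ T := fun i =>
    Finset.single_le_sum (f := r) (fun i _ => hr0 i) (Finset.mem_univ i)
  have hT0 : 0 ≤ T := Finset.sum_nonneg fun i _ => hr0 i
  -- The comparison distribution is the product of the marginals, divided by `T` so that it also has
  -- total mass `T`.
  have key : ∀ i j, negMulLog (d i j) + d i j * (log (r i) + log (c j) - log T) ≤
      r i * c j / T - d i j := by
    intro i j
    have hb : r i * c j / T = 0 → d i j = 0 := by
      intro h
      rcases div_eq_zero_iff.1 h with h | h
      · rcases mul_eq_zero.1 h with h | h
        · exact le_antisymm (h ▸ hdr i j) (hd i j)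
        · exact le_antisymm (h ▸ hdc i j) (hd i j)
      · exact le_antisymm (h ▸ (hdr i j).trans (hrT i)) (hd i j)
    have := negMulLog_add_mul_log_le (hd i j) (div_nonneg (mul_nonneg (hr0 i) (hc0 j)) hT0) hb
    by_cases h0 : d i j = 0
    · simp only [h0, zero_mul, negMulLog_zero, add_zero, sub_zero] at this ⊢
      exact div_nonneg (mul_nonneg (hr0 i) (hc0 j)) hT0
    · have h1 : r i * c j / T ≠ 0 := fun h => h0 (hb h)
      have hT1 : T ≠ 0 := fun h => h1 (by rw [h, div_zero])
      have hri : r i ≠ 0 := fun h => h1 (by rw [h, zero_mul, zero_div])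
      have hcj : c j ≠ 0 := fun h => h1 (by rw [h, mul_zero, zero_div])
      rwa [log_div (mul_ne_zero hri hcj) hT1, log_mul hri hcj] at this
  have hsum := Finset.sum_le_sum fun i (_ : i ∈ Finset.univ) =>
    Finset.sum_le_sum fun j (_ : j ∈ Finset.univ) => key i j
  have e1 : ∑ i, ∑ j, (r i * c j / T - d i j) = 0 := by
    simp only [Finset.sum_sub_distrib, ← Finset.sum_div, ← Finset.mul_sum, ← Finset.sum_mul]
    rw [hTc, hTr, mul_self_div_self]; exact sub_self _
  have e2 : ∑ i, ∑ j, (negMulLog (d i j) + d i j * (log (r i) + log (c j) - log T)) =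
      ∑ i, ∑ j, negMulLog (d i j) + (∑ i, r i * log (r i) + ∑ j, c j * log (c j) - T * log T) := by
    simp only [Finset.sum_add_distrib, mul_add, mul_sub, Finset.sum_sub_distrib, ← Finset.sum_mul]
    rw [Finset.sum_comm (f := fun i j => d i j * log (c j))]
    simp only [← Finset.sum_mul]
    rfl
  rw [e1, e2] at hsum
  have e3 : ∑ i, negMulLog (r i) = -∑ i, r i * log (r i) := by simp [negMulLog]
  have e4 : ∑ j, negMulLog (c j) = -∑ j, c j * log (c j) := by simp [negMulLog]
  rw [e3, e4, negMulLog]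
  linarith

end Classical

/-! ### Entropy of a state and of its diagonal. -/

section Inequalities

variable {I J : Type*} [Fintype I] [DecidableEq I] [Fintype J] [DecidableEq J]

theorem sum_normSq_row {U : Matrix I I ℂ} (h : U * Uᴴ = 1) (i : I) :
    ∑ j, Complex.normSq (U i j) = 1 := by
  have := congrFun (congrFun h i) i
  simp only [mul_apply, conjTranspose_apply, one_apply_eq, Complex.star_def, Complex.mul_conj] at this
  exact_mod_cast this

theorem sum_normSq_col {U : Matrix I I ℂ} (h : Uᴴ * U = 1) (j : I) :
    ∑ i, Complex.normSq (U i j) = 1 := by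
  have := congrFun (congrFun h j) j
  simp only [mul_apply, conjTranspose_apply, one_apply_eq, Complex.star_def,
    mul_comm _ (U _ j), Complex.mul_conj] at this
  exact_mod_cast this

theorem unitary_diagonal_apply_self (U : Matrix I I ℂ) (d : I → ℝ) (i : I) :
    (U * diagonal (fun j => (d j : ℂ)) * Uᴴ) i i = ((∑ j, Complex.normSq (U i j) * d j : ℝ) : ℂ) := by
  rw [mul_apply]
  push_cast
  refine Finset.sum_congr rfl fun j _ => ?_
  rw [mul_diagonal, conjTranspose_apply, Complex.star_def, ← Complex.mul_conj]
  ring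

/-- The entropy is at most the Shannon entropy of the diagonal. -/
theorem entropy_le_diag {ρ : Matrix I I ℂ} (h : ρ.PosSemidef) :
    entropy ρ ≤ ∑ i, negMulLog (ρ i i).re := by
  obtain ⟨U, d, h1, h2, h3, h4, -, h6⟩ := exists_spectral h
  have : ∀ i, (ρ i i).re = ∑ j, Complex.normSq (U i j) * d j := fun i => by
    rw [h3, unitary_diagonal_apply_self, Complex.ofReal_re]
  simp only [this]
  calc entropy ρ = ∑ j, ∑ i, Complex.normSq (U i j) * negMulLog (d j) := by
        simp only [← Finset.sum_mul, sum_normSq_col h1, one_mul, h6]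
    _ = ∑ i, ∑ j, Complex.normSq (U i j) * negMulLog (d j) := Finset.sum_comm
    -- Jensen for the concave `negMulLog`: the squared moduli of the entries of a unitary are doubly
    -- stochastic. Column sums gave the first equality, row sums are the weights here.
    _ ≤ _ := Finset.sum_le_sum fun i _ => by
        simpa using concaveOn_negMulLog.le_map_sum (t := Finset.univ)
          (w := fun j => Complex.normSq (U i j)) (p := d) (fun j _ => Complex.normSq_nonneg _)
          (sum_normSq_row h2 i) (fun j _ => h4 j)

theorem entropy_le_diag_basis {ρ : Matrix I I ℂ} (h : ρ.PosSemidef) {U : Matrix I I ℂ}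
    (hU : Uᴴ * U = 1) : entropy ρ ≤ ∑ i, negMulLog ((Uᴴ * ρ * U) i i).re := by
  have hU' : U * Uᴴ = 1 := mul_eq_one_comm.1 hU
  have := entropy_le_diag (h.conjTranspose_mul_mul_same U)
  rwa [show entropy (Uᴴ * ρ * U) = entropy ρ by
    simpa using entropy_isometry (W := Uᴴ) (by simpa using hU') h.isHermitian] at this

end Inequalities

/-! ### Subadditivity, Gibbs states, efficacy and the quantum Fano inequality. -/

section Inequalities

variable {I J K L : Type*} [Fintype I] [DecidableEq I] [Fintype J] [DecidableEq J]
  [Fintype K] [DecidableEq K] [Fintype L] [DecidableEq L]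

theorem conj_unitary_diagonal {U ρ D : Matrix I I ℂ} (h1 : Uᴴ * U = 1) (h : ρ = U * D * Uᴴ) :
    Uᴴ * ρ * U = D := by
  rw [h]
  simp only [Matrix.mul_assoc]
  rw [h1, Matrix.mul_one, ← Matrix.mul_assoc, h1, Matrix.one_mul]

/-- Subadditivity of the entropy, for unnormalised states. -/
theorem entropy_subadditive (e : I ≃ K × L) {ρ : Matrix I I ℂ} (h : ρ.PosSemidef) :
    entropy ρ + negMulLog ρ.trace.re ≤ entropy (reduce e ρ) + entropy (reduce (compl e) ρ) := by
  obtain ⟨U, d, u1, u2, u3, -, -, u6⟩ := exists_spectral (posSemidef_reduce e h)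
  obtain ⟨V, c, v1, v2, v3, -, -, v6⟩ := exists_spectral (posSemidef_reduce (compl e) h)
  have hU : Uᴴᴴ * Uᴴ = 1 := by rwa [conjTranspose_conjTranspose]
  have hV : Vᴴᴴ * Vᴴ = 1 := by rwa [conjTranspose_conjTranspose]
  -- Local unitaries make both marginals diagonal without changing any entropy. The diagonal of the
  -- rotated state is then a joint distribution whose marginals are the two spectra, and the
  -- classical inequality applies.
  have h₁ := posSemidef_evolve (extend e Uᴴ) h
  set ρ₁ := evolve (extend e Uᴴ) ρ with hρ₁
  have h₂ := posSemidef_evolve (extend (compl e) Vᴴ) h₁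
  set ρ₂ := evolve (extend (compl e) Vᴴ) ρ₁ with hρ₂
  have r1 : reduce e ρ₂ = diagonal fun i => (d i : ℂ) := by
    refine (reduce_compl_evolve (compl e) hV ρ₁).trans ?_
    change reduce e ρ₁ = _
    rw [hρ₁, reduce_evolve, evolve, conjTranspose_conjTranspose, conj_unitary_diagonal u1 u3]
  have r2 : reduce (compl e) ρ₂ = diagonal fun i => (c i : ℂ) := by
    rw [hρ₂, reduce_evolve, hρ₁, reduce_compl_evolve e hU, evolve, conjTranspose_conjTranspose,
      conj_unitary_diagonal v1 v3]
  have ent : entropy ρ₂ = entropy ρ := by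
    rw [hρ₂, entropy_evolve (extend_isometry _ hV) h₁.isHermitian, hρ₁,
      entropy_evolve (extend_isometry _ hU) h.isHermitian]
  have tr : ρ₂.trace = ρ.trace := by
    rw [hρ₂, trace_evolve (extend_isometry _ hV), hρ₁, trace_evolve (extend_isometry _ hU)]
  set D : K → L → ℝ := fun k l => (ρ₂ (e.symm (k, l)) (e.symm (k, l))).re with hD
  have m1 : ∀ k, ∑ l, D k l = d k := fun k => by
    have := congrArg Complex.re (congrFun (congrFun r1 k) k)
    simpa [reduce, hD] using this
  have m2 : ∀ l, ∑ k, D k l = c l := fun l => by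
    have := congrArg Complex.re (congrFun (congrFun r2 l) l)
    simpa [reduce, hD] using this
  have m3 : ∑ k, d k = ρ.trace.re := by
    rw [← tr, ← trace_reduce e, r1]
    simp
  have hD0 : ∀ k l, 0 ≤ D k l := fun k l => (Complex.le_def.1 (h₂.diag_nonneg)).1
  have key := sum_negMulLog_marginals hD0
  have h3 := entropy_le_diag h₂
  rw [← e.symm.sum_comp, Fintype.sum_prod_type, ent] at h3
  simp only [m1, m2, m3] at key
  rw [u6, v6]
  linarith

/-- `τ` is the Gibbs state of the Hamiltonian `H`, written in an energy eigenbasis. -/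
def IsGibbs (θ : ℝ) (H τ : Matrix I I ℂ) : Prop :=
  ∃ (U : Matrix I I ℂ) (h : I → ℝ), Uᴴ * U = 1 ∧ U * Uᴴ = 1 ∧
    H = U * diagonal (fun i => (h i : ℂ)) * Uᴴ ∧
    τ = U * diagonal (fun i => ((exp (-h i / θ) / ∑ j, exp (-h j / θ) : ℝ) : ℂ)) * Uᴴ

theorem isGibbs_thermal (θ : ℝ) {H : Matrix I I ℂ} (hH : H.IsHermitian) :
    IsGibbs θ H (thermal θ H) := by
  obtain ⟨U, h, h1, h2, h3, -, h5⟩ := exists_unitary_diagonal hH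
  refine ⟨U, h, h1, h2, h3, ?_⟩
  rw [thermal, h5, Matrix.trace_mul_comm, ← Matrix.mul_assoc, h1, Matrix.one_mul, trace_diagonal,
    ← Matrix.smul_mul, ← Matrix.mul_smul, ← diagonal_smul]
  congr 3
  ext i
  simp [div_eq_inv_mul]

theorem isGibbs_diagonal (θ : ℝ) (h : I → ℝ) :
    IsGibbs θ (diagonal fun i => (h i : ℂ))
      (diagonal fun i => ((exp (-h i / θ) / ∑ j, exp (-h j / θ) : ℝ) : ℂ)) :=
  ⟨1, h, by simp, by simp, by simp, by simp⟩

/-- The Gibbs state of two systems that do not interact is a product state. -/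
theorem IsGibbs.kronecker {θ : ℝ} {H τ : Matrix I I ℂ} {H' τ' : Matrix J J ℂ}
    (hτ : IsGibbs θ H τ) (hτ' : IsGibbs θ H' τ') :
    IsGibbs θ (H ⊗ₖ (1 : Matrix J J ℂ) + (1 : Matrix I I ℂ) ⊗ₖ H') (τ ⊗ₖ τ') := by
  obtain ⟨U, h, h1, h2, h3, h4⟩ := hτ
  obtain ⟨V, k, k1, k2, k3, k4⟩ := hτ'
  have hd : ∀ (d : I → ℂ) (c : J → ℂ), (U * diagonal d * Uᴴ) ⊗ₖ (V * diagonal c * Vᴴ) =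
      (U ⊗ₖ V) * diagonal (fun i : I × J => d i.1 * c i.2) * (U ⊗ₖ V)ᴴ := fun d c => by
    rw [conjTranspose_kronecker, mul_kronecker_mul, mul_kronecker_mul, diagonal_kronecker_diagonal]
  refine ⟨U ⊗ₖ V, fun i => h i.1 + k i.2, ?_, ?_, ?_, ?_⟩
  · rw [conjTranspose_kronecker, ← mul_kronecker_mul, h1, k1, one_kronecker_one]
  · rw [conjTranspose_kronecker, ← mul_kronecker_mul, h2, k2, one_kronecker_one]
  · have e1 : (1 : Matrix I I ℂ) = U * diagonal (fun _ => 1) * Uᴴ := by simp [h2]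
    have e2 : (1 : Matrix J J ℂ) = V * diagonal (fun _ => 1) * Vᴴ := by simp [k2]
    rw [e1, e2, h3, k3, hd, hd, ← Matrix.add_mul, ← Matrix.mul_add, diagonal_add]
    simp
  · rw [h4, k4, hd]
    congr 3
    ext i
    rw [← Complex.ofReal_mul, Fintype.sum_prod_type, div_mul_div_comm, Finset.sum_mul_sum]
    simp only [neg_add, add_div, exp_add]

theorem posSemidef_unitary_diagonal (U : Matrix I I ℂ) {d : I → ℝ} (hd : ∀ i, 0 ≤ d i) :
    (U * diagonal (fun i => (d i : ℂ)) * Uᴴ).PosSemidef :=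
  (posSemidef_diagonal_iff.2 fun i => by exact_mod_cast hd i).mul_mul_conjTranspose_same U

theorem trace_unitary_diagonal {U : Matrix I I ℂ} (h1 : Uᴴ * U = 1) (d : I → ℂ) :
    (U * diagonal d * Uᴴ).trace = ∑ i, d i := by
  rw [Matrix.trace_mul_comm, ← Matrix.mul_assoc, h1, Matrix.one_mul, trace_diagonal]

theorem IsGibbs.posSemidef {θ : ℝ} {H τ : Matrix I I ℂ} (hτ : IsGibbs θ H τ) :
    τ.PosSemidef := by
  obtain ⟨U, h, -, -, -, rfl⟩ := hτ
  exact posSemidef_unitary_diagonal U fun i => by positivity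

theorem IsGibbs.trace_eq_one [Nonempty I] {θ : ℝ} {H τ : Matrix I I ℂ} (hτ : IsGibbs θ H τ) :
    τ.trace = 1 := by
  obtain ⟨U, h, h1, -, -, rfl⟩ := hτ
  rw [trace_unitary_diagonal h1, ← Complex.ofReal_sum, ← Finset.sum_div, div_self,
    Complex.ofReal_one]
  exact (Finset.sum_pos (fun i _ => exp_pos _) Finset.univ_nonempty).ne'

theorem expectation_unitary_diagonal (U ρ : Matrix I I ℂ) (h : I → ℝ) :
    expectation (U * diagonal (fun i => (h i : ℂ)) * Uᴴ) ρ =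
      ∑ i, ((Uᴴ * ρ * U) i i).re * h i := by
  rw [expectation, ← Matrix.mul_assoc, Matrix.trace_mul_comm, ← Matrix.mul_assoc,
    ← Matrix.mul_assoc]
  simp [trace, mul_diagonal]

/-- The Gibbs state minimises the free energy. -/
theorem IsGibbs.variational {θ : ℝ} (hθ : 0 < θ) {H τ : Matrix I I ℂ} (hτ : IsGibbs θ H τ)
    {ρ : Matrix I I ℂ} (hρ : ρ.PosSemidef) (htr : ρ.trace = 1) :
    θ * (entropy ρ - entropy τ) ≤ expectation H ρ - expectation H τ := by
  have hne : Nonempty I := by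
    by_contra hc
    rw [not_nonempty_iff] at hc
    simp [trace] at htr
  obtain ⟨U, h, h1, h2, h3, h4⟩ := hτ
  set Z := ∑ j, exp (-h j / θ) with hZ
  have hZ0 : 0 < Z := Finset.sum_pos (fun i _ => exp_pos _) Finset.univ_nonempty
  set w : I → ℝ := fun i => exp (-h i / θ) / Z with hw
  have hw0 : ∀ i, 0 < w i := fun i => div_pos (exp_pos _) hZ0
  have hw1 : ∑ i, w i = 1 := by rw [hw, ← Finset.sum_div, ← hZ, div_self hZ0.ne']
  have hlog : ∀ i, log (w i) = -h i / θ - log Z := fun i => by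
    rw [hw, log_div (exp_pos _).ne' hZ0.ne', log_exp]
  set d : I → ℝ := fun i => ((Uᴴ * ρ * U) i i).re with hd
  have hd0 : ∀ i, 0 ≤ d i := fun i =>
    (Complex.le_def.1 (hρ.conjTranspose_mul_mul_same U).diag_nonneg).1
  have hd1 : ∑ i, d i = 1 := by
    have : (Uᴴ * ρ * U).trace = 1 := by
      rw [Matrix.trace_mul_comm, ← Matrix.mul_assoc, h2, Matrix.one_mul, htr]
    simpa [trace] using congrArg Complex.re this
  have eH : ∀ σ, expectation H σ = ∑ i, ((Uᴴ * σ * U) i i).re * h i := fun σ => by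
    rw [h3, expectation_unitary_diagonal]
  have eρ : expectation H ρ = ∑ i, d i * h i := eH ρ
  have eτ : expectation H τ = ∑ i, w i * h i := by
    rw [eH, conj_unitary_diagonal h1 h4]
    simp only [diagonal_apply_eq, Complex.ofReal_re, hw]
  have sτ : entropy τ = (∑ i, w i * h i) / θ + log Z := by
    rw [h4, entropy_unitary_diagonal h1]
    calc ∑ i, negMulLog (w i) = ∑ i, (w i * h i / θ + w i * log Z) :=
          Finset.sum_congr rfl fun i _ => by rw [negMulLog, hlog]; ring
      _ = _ := by rw [Finset.sum_add_distrib, ← Finset.sum_div, ← Finset.sum_mul, hw1, one_mul]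
  -- The diagonal `d` of ρ in the energy basis is compared with the Gibbs weights `w`; since log w =
  -- -h/θ - log Z, the cross entropy is the mean energy over θ plus log Z.
  have sρ : entropy ρ ≤ (∑ i, d i * h i) / θ + log Z := by
    refine (entropy_le_diag_basis hρ h1).trans ?_
    have := Finset.sum_le_sum fun i (_ : i ∈ Finset.univ) =>
      negMulLog_add_mul_log_le (hd0 i) (hw0 i).le fun h => absurd h (hw0 i).ne'
    rw [Finset.sum_sub_distrib, hw1, hd1, sub_self, Finset.sum_add_distrib] at this
    have e : ∑ i, d i * log (w i) = -((∑ i, d i * h i) / θ + log Z) := by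
      calc ∑ i, d i * log (w i) = ∑ i, (-(d i * h i / θ) - d i * log Z) :=
            Finset.sum_congr rfl fun i _ => by rw [hlog]; ring
        _ = _ := by
            rw [Finset.sum_sub_distrib, Finset.sum_neg_distrib, ← Finset.sum_div, ← Finset.sum_mul,
              hd1, one_mul]; ring
    rw [e] at this
    change ∑ i, negMulLog (d i) ≤ _
    linarith
  rw [eρ, eτ, sτ]
  have := mul_le_mul_of_nonneg_left sρ hθ.le
  have e2 : θ * ((∑ i, d i * h i) / θ + log Z) = ∑ i, d i * h i + θ * log Z := by
    field_simp
  have e3 : θ * ((∑ i, w i * h i) / θ + log Z) = ∑ i, w i * h i + θ * log Z := by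
    field_simp
  rw [mul_sub, e3]
  linarith

/-- A positive trace-preserving map of efficacy at most one does not decrease the entropy. -/
theorem entropy_le_of_efficacy_le_one (Φ : Matrix I I ℂ →ₗ[ℂ] Matrix J J ℂ)
    (hpos : ∀ ρ : Matrix I I ℂ, ρ.PosSemidef → (Φ ρ).PosSemidef)
    (htr : ∀ ρ, (Φ ρ).trace = ρ.trace) {ρ : Matrix I I ℂ} (hρ : ρ.PosSemidef)
    (h1 : ρ.trace = 1) (heff : efficacy Φ ρ ≤ 1) : entropy ρ ≤ entropy (Φ ρ) := by
  obtain ⟨U, p, u1, u2, u3, u4, u5, u6⟩ := exists_spectral hρ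
  obtain ⟨V, q, v1, v2, v3, v4, -, v6⟩ := exists_spectral (hpos ρ hρ)
  rw [h1, Complex.one_re] at u5
  set E : I → Matrix I I ℂ := fun i => U * single i i 1 * Uᴴ with hE
  have hE0 : ∀ i, (E i).PosSemidef := fun i => by
    have : (single i i (1 : ℂ)).PosSemidef := by
      rw [← diagonal_single]
      refine posSemidef_diagonal_iff.2 fun j => ?_
      by_cases h : j = i
      · subst h; simp
      · simp [h]
    exact this.mul_mul_conjTranspose_same U
  have hE1 : ∀ i, (E i).trace = 1 := fun i => by
    rw [hE, Matrix.trace_mul_comm, ← Matrix.mul_assoc, u1, Matrix.one_mul]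
    simp
  have hsum : ∀ f : I → ℂ, U * diagonal f * Uᴴ = ∑ i, f i • E i := fun f => by
    rw [show diagonal f = ∑ i, f i • single i i (1 : ℂ) by
      rw [← Matrix.sum_single_eq_diagonal]; simp [smul_single], Matrix.mul_sum, Matrix.sum_mul]
    simp only [hE, Matrix.mul_smul, Matrix.smul_mul]
  have hρE : ρ = ∑ i, (p i : ℂ) • E i := by rw [← hsum, ← u3]
  have hone : (1 : Matrix I I ℂ) = ∑ i, E i := by
    have := hsum fun _ => 1
    simpa [u2] using this
  -- Between the eigenbases of ρ and Φ(ρ), Φ acts as a classical channel κ with q = pκ. Only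
  -- positivity of Φ enters here, not complete positivity.
  set κ : I → J → ℝ := fun i j => ((Vᴴ * Φ (E i) * V) j j).re with hκ
  have hκ0 : ∀ i j, 0 ≤ κ i j := fun i j =>
    (Complex.le_def.1 ((hpos _ (hE0 i)).conjTranspose_mul_mul_same V).diag_nonneg).1
  have hκ1 : ∀ i, ∑ j, κ i j = 1 := fun i => by
    have : (Vᴴ * Φ (E i) * V).trace = 1 := by
      rw [Matrix.trace_mul_comm, ← Matrix.mul_assoc, v2, Matrix.one_mul, htr, hE1]
    simpa [trace] using congrArg Complex.re this
  have hq : ∀ j, q j = ∑ i, p i * κ i j := fun j => by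
    have := congrFun (congrFun (conj_unitary_diagonal v1 v3) j) j
    rw [hρE, map_sum, Matrix.mul_sum, Matrix.sum_mul, Matrix.sum_apply] at this
    have := congrArg Complex.re this
    simpa [hκ] using this.symm
  -- The efficacy is Tr[Φ(ρ) Φ(1)], with the identity resolved into the eigenprojectors of ρ.
  have hEff : efficacy Φ ρ = ∑ i, ∑ j, κ i j * q j := by
    rw [efficacy, ← Matrix.mul_one (traceAdjoint _ _), trace_traceAdjoint_mul, hone, map_sum,
      Matrix.mul_sum, trace_sum, Complex.re_sum]
    refine Finset.sum_congr rfl fun i _ => ?_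
    rw [Matrix.trace_mul_comm]
    conv_lhs => rw [v3]
    exact expectation_unitary_diagonal V _ q
  -- Summed over i and j, the left side is H(p) - H(q) and the right side is the efficacy minus 1.
  have key : ∀ i j, κ i j * (negMulLog (p i) + p i * log (q j)) ≤ κ i j * (q j - p i) := by
    intro i j
    rcases (hκ0 i j).eq_or_lt with h | h
    · simp [← h]
    · refine mul_le_mul_of_nonneg_left (negMulLog_add_mul_log_le (u4 i) (v4 j) fun h0 => ?_) h.le
      rw [hq, Finset.sum_eq_zero_iff_of_nonneg fun i _ => mul_nonneg (u4 i) (hκ0 i j)] at h0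
      exact (mul_eq_zero.1 (h0 i (Finset.mem_univ i))).resolve_right h.ne'
  have hs := Finset.sum_le_sum fun i (_ : i ∈ Finset.univ) =>
    Finset.sum_le_sum fun j (_ : j ∈ Finset.univ) => key i j
  have e1 : ∑ i, ∑ j, κ i j * (q j - p i) = efficacy Φ ρ - 1 := by
    simp only [mul_sub, Finset.sum_sub_distrib, ← Finset.sum_mul, hκ1, one_mul, u5, hEff]
  have e2 : ∑ i, ∑ j, κ i j * (negMulLog (p i) + p i * log (q j)) =
      ∑ i, negMulLog (p i) - ∑ j, negMulLog (q j) := by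
    simp only [mul_add, Finset.sum_add_distrib, ← Finset.sum_mul, hκ1, one_mul]
    rw [Finset.sum_comm, sub_eq_add_neg, ← Finset.sum_neg_distrib]
    congr 1
    refine Finset.sum_congr rfl fun j _ => ?_
    rw [negMulLog, neg_mul, neg_neg]
    nth_rewrite 2 [hq j]
    rw [Finset.sum_mul]
    exact Finset.sum_congr rfl fun i _ => by ring
  rw [e1, e2] at hs
  rw [u6, v6]
  linarith

/-- Quantum Fano inequality. -/
theorem entropy_le_fano {ρ : Matrix I I ℂ} (hρ : ρ.PosSemidef) (h1 : ρ.trace = 1) {ψ : I → ℂ}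
    (hψ : ∑ i, ‖ψ i‖ ^ 2 = 1) {D : ℝ} (hD : (Fintype.card I : ℝ) - 1 ≤ D)
    (F : ℝ) (hF : F = (star ψ ⬝ᵥ (ρ.mulVec ψ)).re) :
    0 ≤ F ∧ F ≤ 1 ∧ entropy ρ ≤ binEntropy F + (1 - F) * log D := by
  obtain ⟨U, p, u1, u2, u3, u4, u5, u6⟩ := exists_spectral hρ
  rw [h1, Complex.one_re] at u5
  set φ : I → ℂ := Uᴴ *ᵥ ψ with hφ
  set w : I → ℝ := fun j => Complex.normSq (φ j) with hw
  have hw0 : ∀ j, 0 ≤ w j := fun j => Complex.normSq_nonneg _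
  have hφφ : star φ = star ψ ᵥ* U := by rw [hφ, star_mulVec, conjTranspose_conjTranspose]
  have hw1 : ∑ j, w j = 1 := by
    have : star φ ⬝ᵥ φ = star ψ ⬝ᵥ ψ := by
      rw [hφφ, hφ, dotProduct_mulVec, vecMul_vecMul, u2, vecMul_one]
    simp only [dotProduct, Pi.star_apply, Complex.star_def, ← Complex.normSq_eq_conj_mul_self,
      Complex.normSq_eq_norm_sq] at this
    rw [← hψ, hw]
    simp only [Complex.normSq_eq_norm_sq]
    exact_mod_cast this
  have hF' : F = ∑ j, w j * p j := by
    rw [hF, u3, ← mulVec_mulVec, ← mulVec_mulVec, dotProduct_mulVec, ← hφφ, ← hφ]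
    simp only [dotProduct, mulVec_diagonal, Pi.star_apply, Complex.re_sum]
    refine Finset.sum_congr rfl fun j _ => ?_
    rw [show star (φ j) * ((p j : ℂ) * φ j) = ((w j * p j : ℝ) : ℂ) by
      rw [Complex.ofReal_mul, hw, Complex.normSq_eq_conj_mul_self, Complex.star_def]; ring,
      Complex.ofReal_re]
  have hw1' : ∀ j, w j ≤ 1 := fun j => by
    rw [← hw1]
    exact Finset.single_le_sum (f := w) (fun j _ => hw0 j) (Finset.mem_univ j)
  have hF'' : 1 - F = ∑ j, (1 - w j) * p j := by
    simp only [sub_mul, one_mul, Finset.sum_sub_distrib, u5, hF']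
  have hF0 : 0 ≤ F := hF' ▸ Finset.sum_nonneg fun j _ => mul_nonneg (hw0 j) (u4 j)
  have hF1 : 0 ≤ 1 - F := hF'' ▸ Finset.sum_nonneg fun j _ =>
    mul_nonneg (sub_nonneg.2 (hw1' j)) (u4 j)
  refine ⟨hF0, sub_nonneg.1 hF1, ?_⟩
  have hcard : ∑ j : I, (1 - w j) = (Fintype.card I : ℝ) - 1 := by
    simp [Finset.sum_sub_distrib, hw1]
  have hD0 : 0 ≤ D := (hcard ▸ Finset.sum_nonneg fun j _ => sub_nonneg.2 (hw1' j)).trans hD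
  -- Each eigenvalue `p j` is split in the proportion `w j : 1 - w j`. The first part is compared
  -- with F, the second with the uniform value G that spreads the remaining mass over `D` levels.
  set G := (1 - F) / D with hG
  have hG0 : 0 ≤ G := div_nonneg hF1 hD0
  have k1 : ∀ j, w j * (negMulLog (p j) + p j * log F) ≤ w j * (F - p j) := by
    intro j
    rcases (hw0 j).eq_or_lt with h | h
    · simp [← h]
    · refine mul_le_mul_of_nonneg_left (negMulLog_add_mul_log_le (u4 j) hF0 fun h0 => ?_) h.le
      rw [hF', Finset.sum_eq_zero_iff_of_nonneg fun i _ => mul_nonneg (hw0 i) (u4 i)] at h0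
      exact (mul_eq_zero.1 (h0 j (Finset.mem_univ j))).resolve_left h.ne'
  have k2 : ∀ j, (1 - w j) * (negMulLog (p j) + p j * log G) ≤ (1 - w j) * (G - p j) := by
    intro j
    rcases (sub_nonneg.2 (hw1' j)).eq_or_lt with h | h
    · simp [← h]
    · refine mul_le_mul_of_nonneg_left (negMulLog_add_mul_log_le (u4 j) hG0 fun h0 => ?_) h.le
      have hDpos : 0 < D := lt_of_lt_of_le (hcard ▸ lt_of_lt_of_le h
        (Finset.single_le_sum (f := fun j => 1 - w j) (fun j _ => sub_nonneg.2 (hw1' j))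
          (Finset.mem_univ j))) hD
      have h0' := (div_eq_zero_iff.1 h0).resolve_right hDpos.ne'
      rw [hF'', Finset.sum_eq_zero_iff_of_nonneg fun i _ =>
        mul_nonneg (sub_nonneg.2 (hw1' i)) (u4 i)] at h0'
      exact (mul_eq_zero.1 (h0' j (Finset.mem_univ j))).resolve_left h.ne'
  have hs := Finset.sum_le_sum fun j (_ : j ∈ Finset.univ) => add_le_add (k1 j) (k2 j)
  have e1 : ∑ j, (w j * (negMulLog (p j) + p j * log F) +
      (1 - w j) * (negMulLog (p j) + p j * log G)) =
      ∑ j, negMulLog (p j) + F * log F + (1 - F) * log G := by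
    rw [hF'', hF', Finset.sum_mul, Finset.sum_mul, ← Finset.sum_add_distrib,
      ← Finset.sum_add_distrib]
    refine Finset.sum_congr rfl fun j _ => ?_
    rw [← hF']; ring
  have e2 : ∑ j, (w j * (F - p j) + (1 - w j) * (G - p j)) =
      F + ((Fintype.card I : ℝ) - 1) * G - 1 := by
    calc _ = ∑ j, (w j * F + (1 - w j) * G - p j) := Finset.sum_congr rfl fun j _ => by ring
      _ = _ := by
        rw [Finset.sum_sub_distrib, Finset.sum_add_distrib, ← Finset.sum_mul, ← Finset.sum_mul,
          hw1, u5, hcard, one_mul]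
  have e3 : ((Fintype.card I : ℝ) - 1) * G ≤ 1 - F := by
    refine (mul_le_mul_of_nonneg_right hD hG0).trans ?_
    rcases hD0.eq_or_lt with h | h
    · simpa [← h] using hF1
    · rw [hG, mul_div_cancel₀ _ h.ne']
  rw [e1, e2] at hs
  rw [u6, binEntropy_eq_negMulLog_add_negMulLog_one_sub, negMulLog, negMulLog]
  have e4 : (1 - F) * log G = (1 - F) * log (1 - F) - (1 - F) * log D := by
    rcases hF1.eq_or_lt with h | h
    · simp [← h]
    rcases hD0.eq_or_lt with h' | h'
    -- For `D = 0` all `1 - w j` vanish, as their sum is at most `D`; then 1 - F would be 0.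
    · exfalso
      have hz : ∀ j, 1 - w j = 0 := fun j =>
        (Finset.sum_eq_zero_iff_of_nonneg fun j _ => sub_nonneg.2 (hw1' j)).1
          (le_antisymm (hcard.trans_le (h' ▸ hD)) (Finset.sum_nonneg fun j _ =>
            sub_nonneg.2 (hw1' j))) j (Finset.mem_univ j)
      rw [hF''] at h
      simp [hz] at h
    · rw [hG, log_div h.ne' h'.ne']; ring
  linarith

theorem le_fanoMaximum {d : ℕ} {s F : ℝ} (h0 : 0 ≤ F) (h1 : F ≤ 1)
    (h : s ≤ binEntropy F + (1 - F) * log ((d : ℝ) ^ 2 - 1)) : F ≤ fanoMaximum d s :=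
  le_csSup ⟨1, fun _ hx => hx.2.1⟩ ⟨h0, h1, h⟩

theorem fanoMaximum_le_one (d : ℕ) (s : ℝ) : fanoMaximum d s ≤ 1 :=
  Real.sSup_le (fun _ hx => hx.2.1) zero_le_one

/-- The admissible set is compact, so its supremum 1 is attained, and the Fano bound vanishes at F =
1. The set is nonempty because `sSup ∅ = 0`. -/
theorem nonpos_of_fanoMaximum_eq_one {d : ℕ} {s : ℝ} (h : fanoMaximum d s = 1) : s ≤ 0 := by
  rw [fanoMaximum] at h
  set T : Set ℝ := {F | 0 ≤ F ∧ F ≤ 1 ∧ s ≤ binEntropy F + (1 - F) * log ((d : ℝ) ^ 2 - 1)}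
  have hne : T.Nonempty := by
    by_contra hc
    rw [Set.not_nonempty_iff_eq_empty] at hc
    simp [hc] at h
  have hT : IsCompact T := by
    have : T = Set.Icc 0 1 ∩ {F | s ≤ binEntropy F + (1 - F) * log ((d : ℝ) ^ 2 - 1)} := by
      ext F; simp [T, and_assoc]
    rw [this]
    refine isCompact_Icc.inter_right (isClosed_le continuous_const ?_)
    have := binEntropy_continuous
    fun_prop
  have := (hT.sSup_mem hne).2.2
  rw [h] at this
  simpa using this

end Inequalities

/-! ### Iterated partial traces, classical-quantum states and pure states. -/

section Composite

variable {I J K L K' L' N : Type*} [Fintype I] [DecidableEq I] [Fintype J] [DecidableEq J]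
  [Fintype K] [DecidableEq K] [Fintype L] [DecidableEq L] [Fintype K'] [DecidableEq K']
  [Fintype L'] [DecidableEq L'] [Fintype N] [DecidableEq N]

/-- The hypothesis `h` only compares relabellings of indices, with `s` reordering the systems traced
out, so for concrete splittings it holds by `rfl`. -/
theorem reduce_reduce (e : I ≃ K × L) (f : K ≃ K' × L') (g : I ≃ K' × N) (s : L' × L ≃ N)
    (h : ∀ k l' l, g.symm (k, s (l', l)) = e.symm (f.symm (k, l'), l)) (ρ : Matrix I I ℂ) :
    reduce f (reduce e ρ) = reduce g ρ := by
  ext k k'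
  simp only [reduce, of_apply]
  rw [← s.sum_comp, Fintype.sum_prod_type]
  simp only [h]

theorem reduce_equiv (g : I ≃ K × L) (g' : J ≃ K × N) (σ : I ≃ J) (s : L ≃ N)
    (h : ∀ k l, σ (g.symm (k, l)) = g'.symm (k, s l)) (ρ : Matrix J J ℂ) :
    reduce g (ρ.submatrix σ σ) = reduce g' ρ := by
  ext k k'
  simp only [reduce, of_apply, submatrix_apply, h]
  rw [← s.sum_comp]

theorem reduce_kronecker_left (ρ : Matrix K K ℂ) (τ : Matrix L L ℂ) :
    reduce (Equiv.refl _) (ρ ⊗ₖ τ) = τ.trace • ρ := by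
  ext k k'
  simp [reduce, trace, ← Finset.mul_sum, mul_comm]

theorem reduce_kronecker_right (ρ : Matrix K K ℂ) (τ : Matrix L L ℂ) :
    reduce (Equiv.prodComm _ _) (ρ ⊗ₖ τ) = ρ.trace • τ := by
  ext k k'
  simp [reduce, trace, ← Finset.sum_mul]

theorem posSemidef_blockDiagonal {M : J → Matrix I I ℂ} (h : ∀ j, (M j).PosSemidef) :
    (blockDiagonal M).PosSemidef := by
  have : blockDiagonal M = ∑ j, M j ⊗ₖ single j j (1 : ℂ) := by
    ext ⟨i, j⟩ ⟨i', j'⟩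
    simp only [blockDiagonal_apply, Matrix.sum_apply, kroneckerMap_apply, single_apply]
    by_cases hj : j = j'
    · subst hj; simp
    · rw [if_neg hj, Finset.sum_eq_zero]
      intro k _
      rw [if_neg (fun h => hj (h.1.symm.trans h.2)), mul_zero]
  rw [this]
  refine posSemidef_sum _ fun j _ => (h j).kronecker ?_
  rw [← diagonal_single]
  refine posSemidef_diagonal_iff.2 fun k => ?_
  by_cases h : k = j
  · subst h; simp
  · simp [h]

theorem reduce_blockDiagonal (M : J → Matrix I I ℂ) :
    reduce (Equiv.refl _) (blockDiagonal M) = ∑ j, M j := by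
  ext
  simp [reduce, blockDiagonal_apply, Matrix.sum_apply]

theorem reduce_prodComm_blockDiagonal (M : J → Matrix I I ℂ) :
    reduce (Equiv.prodComm _ _) (blockDiagonal M) = diagonal fun j => (M j).trace := by
  ext j j'
  by_cases h : j = j'
  · subst h; simp [reduce, blockDiagonal_apply, trace]
  · simp [reduce, blockDiagonal_apply, h]

/-- Partial trace over a part of the quantum system of a classical-quantum state. -/
theorem reduce_blockDiagonal_of_quantum (e : I ≃ K × L) (g : I × J ≃ (K × J) × L)
    (h : ∀ k j l, g.symm ((k, j), l) = (e.symm (k, l), j)) (M : J → Matrix I I ℂ) :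
    reduce g (blockDiagonal M) = blockDiagonal fun j => reduce e (M j) := by
  ext ⟨k, j⟩ ⟨k', j'⟩
  by_cases hj : j = j'
  · subst hj; simp [reduce, h, blockDiagonal_apply]
  · simp [reduce, h, blockDiagonal_apply, hj]

theorem trace_eq_ofReal {ρ : Matrix I I ℂ} (h : ρ.PosSemidef) :
    ρ.trace = (ρ.trace.re : ℂ) := by
  have h0 : 0 ≤ ρ.trace := Finset.sum_nonneg fun i _ => h.diag_nonneg
  exact Complex.ext rfl (Complex.le_def.1 h0).2.symm

theorem trace_re_nonneg {ρ : Matrix I I ℂ} (h : ρ.PosSemidef) : 0 ≤ ρ.trace.re :=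
  (Complex.le_def.1 (Finset.sum_nonneg fun _ _ => h.diag_nonneg : 0 ≤ ρ.trace)).1

/-- Holevo's bound for the entropy of a mixture of unnormalised states. -/
theorem sum_entropy_le {M : J → Matrix I I ℂ} (h : ∀ j, (M j).PosSemidef) :
    ∑ j, entropy (M j) + negMulLog (∑ j, (M j).trace.re) ≤
      entropy (∑ j, M j) + ∑ j, negMulLog (M j).trace.re := by
  have := entropy_subadditive (Equiv.refl (I × J)) (posSemidef_blockDiagonal h)
  rw [entropy_blockDiagonal fun j => (h j).isHermitian, trace_blockDiagonal, Complex.re_sum,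
    reduce_blockDiagonal, show compl (Equiv.refl (I × J)) = Equiv.prodComm I J from rfl,
    reduce_prodComm_blockDiagonal,
    show (fun j => (M j).trace) = fun j => ((M j).trace.re : ℂ) from
      funext fun j => trace_eq_ofReal (h j)] at this
  rwa [entropy_diagonal] at this

theorem posSemidef_pureState (v : I → ℂ) : (pureState v).PosSemidef :=
  posSemidef_vecMulVec_self_star v

theorem trace_pureState {v : I → ℂ} (h : ∑ i, ‖v i‖ ^ 2 = 1) : (pureState v).trace = 1 := by
  rw [pureState, trace_vecMulVec]
  simp only [dotProduct, Pi.star_apply, Complex.star_def, Complex.mul_conj,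
    Complex.normSq_eq_norm_sq]
  exact_mod_cast h

theorem entropy_pureState {v : I → ℂ} (h : ∑ i, ‖v i‖ ^ 2 = 1) : entropy (pureState v) = 0 := by
  set W : Matrix I Unit ℂ := replicateCol Unit v with hW
  have h1 : Wᴴ * W = 1 := by
    ext i j
    have := trace_pureState h
    rw [pureState, trace_vecMulVec] at this
    simpa [hW, mul_apply, dotProduct, mul_comm] using this
  have h2 : pureState v = W * diagonal (fun _ : Unit => ((1 : ℝ) : ℂ)) * Wᴴ := by
    ext i j
    simp [hW, pureState, vecMulVec_apply, mul_apply]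
  rw [h2, entropy_unitary_diagonal h1]
  simp

theorem posSemidef_ofReal_smul {ρ : Matrix I I ℂ} (h : ρ.PosSemidef) {c : ℝ} (hc : 0 ≤ c) :
    ((c : ℂ) • ρ).PosSemidef := h.smul (by exact_mod_cast hc)

end Composite

/-! ### The engine: states, entropies and marginals along the cycle. -/

namespace Engine

variable {R S A B C M Y : Type*}
    [Fintype R] [Fintype S] [Fintype A] [Fintype B] [Fintype C] [Fintype M] [Fintype Y]
    [DecidableEq R] [DecidableEq S] [DecidableEq A] [DecidableEq B] [DecidableEq C]
    [DecidableEq M] [DecidableEq Y]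
    (𝓔 : Engine R S A B C M Y)

theorem unitary_isometry {I : Type*} [Fintype I] [DecidableEq I] (U : Matrix.unitaryGroup I ℂ) :
    (U : Matrix I I ℂ)ᴴ * (U : Matrix I I ℂ) = 1 := Unitary.coe_star_mul_self U

/-! #### Thermal states -/

theorem pX_nonneg (x : A) : 0 ≤ 𝓔.pX x := by unfold pX; positivity

theorem sum_pX [Nonempty A] : ∑ x, 𝓔.pX x = 1 := by
  simp only [pX]
  rw [← Finset.sum_div, div_self]
  exact (Finset.sum_pos (fun i _ => exp_pos _) Finset.univ_nonempty).ne'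

theorem θh_pos : 0 < 𝓔.kB * 𝓔.Th := mul_pos 𝓔.kB_pos (𝓔.Tc_pos.trans_le 𝓔.Tc_le_Th)

theorem θc_pos : 0 < 𝓔.kB * 𝓔.Tc := mul_pos 𝓔.kB_pos 𝓔.Tc_pos

theorem θm_pos : 0 < 𝓔.kB * 𝓔.Tm := mul_pos 𝓔.kB_pos 𝓔.Tm_pos

theorem isGibbs_τHot : IsGibbs (𝓔.kB * 𝓔.Th) 𝓔.HB 𝓔.τHot := isGibbs_thermal _ 𝓔.HB_herm

theorem isGibbs_τM : IsGibbs (𝓔.kB * 𝓔.Tm) 𝓔.HM 𝓔.τM := isGibbs_thermal _ 𝓔.HM_herm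

theorem isGibbs_τA : IsGibbs (𝓔.kB * 𝓔.Tc) 𝓔.HA 𝓔.τA := isGibbs_diagonal _ _

theorem isGibbs_τCold : IsGibbs (𝓔.kB * 𝓔.Tc) 𝓔.HCold 𝓔.τCold :=
  𝓔.isGibbs_τA.kronecker (isGibbs_thermal _ 𝓔.HC_herm)

theorem entropy_τA : entropy 𝓔.τA = ∑ x, negMulLog (𝓔.pX x) := entropy_diagonal _

/-! #### The state after the noise -/

theorem σ0_norm (x : A) :
    ∑ i : R × S × A, ‖𝓔.ψ (i.1, i.2.1) * if i.2.2 = x then 1 else 0‖ ^ 2 = 1 := by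
  rw [← 𝓔.ψ_norm, Fintype.sum_prod_type, Fintype.sum_prod_type]
  simp only [Fintype.sum_prod_type]
  refine Finset.sum_congr rfl fun r _ => Finset.sum_congr rfl fun s _ => ?_
  rw [Finset.sum_eq_single x]
  · simp
  · intro a _ h; simp [h]
  · simp

theorem posSemidef_σ0 (x : A) : (𝓔.σ0 x).PosSemidef := posSemidef_pureState _

theorem posSemidef_σenc (x : A) : (𝓔.σenc x).PosSemidef :=
  posSemidef_evolve _ (𝓔.posSemidef_σ0 x)

theorem trace_σenc (x : A) : (𝓔.σenc x).trace = 1 := by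
  rw [σenc, trace_evolve (extend_isometry _ (unitary_isometry _)), σ0,
    trace_pureState (𝓔.σ0_norm x)]

theorem entropy_σenc (x : A) : entropy (𝓔.σenc x) = 0 := by
  rw [σenc, entropy_evolve (extend_isometry _ (unitary_isometry _))
    (𝓔.posSemidef_σ0 x).isHermitian, σ0, entropy_pureState (𝓔.σ0_norm x)]

/-- State of `RSAB` after the noise, given `x`. -/
def σnoise (x : A) : Matrix ((R × S × A) × B) ((R × S × A) × B) ℂ :=
  evolve (extend splitRSAB (𝓔.Uh : Matrix ((S × A) × B) ((S × A) × B) ℂ)) (𝓔.σenc x ⊗ₖ 𝓔.τHot)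

theorem σ1_eq (x : A) : 𝓔.σ1 x = 𝓔.σnoise x ⊗ₖ 𝓔.τCold := rfl

theorem posSemidef_σnoise (x : A) : (𝓔.σnoise x).PosSemidef :=
  posSemidef_evolve _ ((𝓔.posSemidef_σenc x).kronecker 𝓔.isGibbs_τHot.posSemidef)

theorem trace_σnoise [Nonempty B] (x : A) : (𝓔.σnoise x).trace = 1 := by
  rw [σnoise, trace_evolve (extend_isometry _ (unitary_isometry _)), trace_kronecker,
    trace_σenc, 𝓔.isGibbs_τHot.trace_eq_one, one_mul]

theorem entropy_σnoise [Nonempty B] (x : A) : entropy (𝓔.σnoise x) = entropy 𝓔.τHot := by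
  have h := (𝓔.posSemidef_σenc x).kronecker 𝓔.isGibbs_τHot.posSemidef
  rw [σnoise, entropy_evolve (extend_isometry _ (unitary_isometry _)) h.isHermitian,
    entropy_kronecker (𝓔.posSemidef_σenc x) 𝓔.isGibbs_τHot.posSemidef, trace_σenc, entropy_σenc]
  simp

theorem posSemidef_σ1 (x : A) : (𝓔.σ1 x).PosSemidef :=
  (𝓔.posSemidef_σnoise x).kronecker 𝓔.isGibbs_τCold.posSemidef

theorem trace_σ1 [Nonempty A] [Nonempty B] [Nonempty C] (x : A) : (𝓔.σ1 x).trace = 1 := by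
  rw [σ1_eq, trace_kronecker, trace_σnoise, 𝓔.isGibbs_τCold.trace_eq_one, one_mul]

/-- Given `x`, `RSA` enters the noise pure and the noise is unitary, so only the baths contribute.
-/
theorem entropy_σ1 [Nonempty A] [Nonempty B] [Nonempty C] (x : A) :
    entropy (𝓔.σ1 x) = entropy 𝓔.τHot + entropy 𝓔.τCold := by
  rw [σ1_eq, entropy_kronecker (𝓔.posSemidef_σnoise x) 𝓔.isGibbs_τCold.posSemidef, trace_σnoise,
    entropy_σnoise, 𝓔.isGibbs_τCold.trace_eq_one]
  simp

/-! #### The syndrome instrument -/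

variable {𝓔} in
theorem isometry_Umeas (x : A) :
    (extend (splitSAM (R := R) (B := B) (C := C))
      (𝓔.Umeas x : Matrix ((S × A) × M) ((S × A) × M) ℂ))ᴴ *
    extend (splitSAM (R := R) (B := B) (C := C))
      (𝓔.Umeas x : Matrix ((S × A) × M) ((S × A) × M) ℂ) = 1 :=
  extend_isometry _ (unitary_isometry _)

theorem posSemidef_interact (x : A) {ρ : Matrix (Total R S A B C) (Total R S A B C) ℂ}
    (h : ρ.PosSemidef) : (𝓔.interact x ρ).PosSemidef :=
  posSemidef_evolve _ (h.kronecker 𝓔.isGibbs_τM.posSemidef)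

theorem trace_interact [Nonempty M] (x : A)
    (ρ : Matrix (Total R S A B C) (Total R S A B C) ℂ) :
    (𝓔.interact x ρ).trace = ρ.trace := by
  rw [interact, trace_evolve (isometry_Umeas x), trace_kronecker, 𝓔.isGibbs_τM.trace_eq_one,
    mul_one]

theorem one_kronecker_eq_extend {E : Type*} [Fintype E] [DecidableEq E] (T : Matrix M M ℂ) :
    (1 : Matrix E E ℂ) ⊗ₖ T = extend (Equiv.prodComm E M) T := by
  ext i j
  by_cases h : i.1 = j.1 <;> simp [extend_apply, kroneckerMap_apply, one_apply, h]

theorem P_mul_self (x : A) (y : Y) : 𝓔.P x y * 𝓔.P x y = 𝓔.P x y := by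
  rw [𝓔.P_mul, if_pos rfl]

/-- Inside the trace over `M` the projector can be doubled and one copy moved to the left. The
sandwiched form makes positivity evident. -/
theorem instr_eq (x : A) (y : Y) (ρ : Matrix (Total R S A B C) (Total R S A B C) ℂ) :
    𝓔.instr x y ρ = reduce (Equiv.refl _)
      (extend (Equiv.prodComm _ M) (𝓔.P x y) * 𝓔.interact x ρ *
        (extend (Equiv.prodComm _ M) (𝓔.P x y))ᴴ) := by
  have h := reduce_compl_extend_comm (Equiv.prodComm (Total R S A B C) M) (𝓔.P x y)
    (𝓔.interact x ρ * extend (Equiv.prodComm _ M) (𝓔.P x y))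
  rw [Matrix.mul_assoc (𝓔.interact x ρ), ← extend_mul, P_mul_self, ← Matrix.mul_assoc] at h
  rw [← extend_conjTranspose, (𝓔.P_herm x y).eq, instr, one_kronecker_eq_extend]
  exact h.symm

theorem posSemidef_instr (x : A) (y : Y) {ρ : Matrix (Total R S A B C) (Total R S A B C) ℂ}
    (h : ρ.PosSemidef) : (𝓔.instr x y ρ).PosSemidef := by
  rw [instr_eq]
  exact posSemidef_reduce _ ((𝓔.posSemidef_interact x h).mul_mul_conjTranspose_same _)

theorem sum_instr (x : A) (ρ : Matrix (Total R S A B C) (Total R S A B C) ℂ) :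
    ∑ y, 𝓔.instr x y ρ = reduce (Equiv.refl _) (𝓔.interact x ρ) := by
  simp only [instr]
  rw [← reduce_sum, ← Matrix.mul_sum]
  congr 1
  have : ∑ y, (1 : Matrix (Total R S A B C) (Total R S A B C) ℂ) ⊗ₖ 𝓔.P x y = 1 := by
    simp only [one_kronecker_eq_extend]
    have h : ∑ y, extend (Equiv.prodComm (Total R S A B C) M) (𝓔.P x y) =
        extend (Equiv.prodComm (Total R S A B C) M) (∑ y, 𝓔.P x y) := by
      ext i j
      simp only [Matrix.sum_apply, extend_apply]
      split_ifs <;> simp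
    rw [h, 𝓔.P_sum, extend_one]
  rw [this, Matrix.mul_one]

theorem sum_trace_instr [Nonempty M] (x : A)
    (ρ : Matrix (Total R S A B C) (Total R S A B C) ℂ) :
    ∑ y, (𝓔.instr x y ρ).trace = ρ.trace := by
  rw [← trace_sum, sum_instr, trace_reduce, trace_interact]

theorem interact_add (x : A) (ρ σ : Matrix (Total R S A B C) (Total R S A B C) ℂ) :
    𝓔.interact x (ρ + σ) = 𝓔.interact x ρ + 𝓔.interact x σ := by
  simp only [interact, evolve, add_kronecker, Matrix.mul_add, Matrix.add_mul]

theorem interact_smul (x : A) (c : ℂ) (ρ : Matrix (Total R S A B C) (Total R S A B C) ℂ) :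
    𝓔.interact x (c • ρ) = c • 𝓔.interact x ρ := by
  simp only [interact, evolve, smul_kronecker, Matrix.mul_smul, Matrix.smul_mul]

/-- The instrument as a linear map. -/
def instrumentₗ (x : A) : Matrix (Total R S A B C) (Total R S A B C) ℂ →ₗ[ℂ]
    Matrix (Total R S A B C × Y) (Total R S A B C × Y) ℂ where
  toFun := 𝓔.instrument x
  map_add' ρ σ := by
    simp only [instrument, ← blockDiagonal_add]
    congr 1; ext1 y
    simp only [instr, interact_add, Matrix.add_mul, reduce_add, Pi.add_apply]
  map_smul' c ρ := by
    simp only [instrument, RingHom.id_apply, ← blockDiagonal_smul]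
    congr 1; ext1 y
    simp only [instr, interact_smul, Matrix.smul_mul, reduce_smul, Pi.smul_apply]

/-- The syndrome measurement does not decrease the entropy if its efficacy is at most one. -/
theorem entropy_σ1_le [Nonempty A] [Nonempty B] [Nonempty C] [Nonempty M] (x : A)
    (h : 𝓔.instrumentEfficacy x ≤ 1) :
    entropy (𝓔.σ1 x) ≤ ∑ y, entropy (𝓔.instr x y (𝓔.σ1 x)) := by
  rw [← entropy_blockDiagonal fun y => (𝓔.posSemidef_instr x y (𝓔.posSemidef_σ1 x)).isHermitian]
  exact entropy_le_of_efficacy_le_one (𝓔.instrumentₗ x)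
    (fun ρ hρ => posSemidef_blockDiagonal fun y => 𝓔.posSemidef_instr x y hρ)
    (fun ρ => (trace_blockDiagonal _).trans (𝓔.sum_trace_instr x ρ))
    (𝓔.posSemidef_σ1 x) (𝓔.trace_σ1 x) h

/-- Probability of the syndrome `y`, given `x`. -/
def pY (x : A) (y : Y) : ℝ := (𝓔.instr x y (𝓔.σ1 x)).trace.re

theorem trace_instr (x : A) (y : Y) : (𝓔.instr x y (𝓔.σ1 x)).trace = (𝓔.pY x y : ℂ) :=
  trace_eq_ofReal (𝓔.posSemidef_instr x y (𝓔.posSemidef_σ1 x))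

theorem pY_nonneg (x : A) (y : Y) : 0 ≤ 𝓔.pY x y :=
  trace_re_nonneg (𝓔.posSemidef_instr x y (𝓔.posSemidef_σ1 x))

theorem sum_pY [Nonempty A] [Nonempty B] [Nonempty C] [Nonempty M] (x : A) :
    ∑ y, 𝓔.pY x y = 1 := by
  have := 𝓔.sum_trace_instr x (𝓔.σ1 x)
  rw [trace_σ1] at this
  simp only [trace_instr] at this
  exact_mod_cast this

/-! #### Entropies along the cycle -/

/-- The final unnormalised state of `E`, given `x` and `y`. -/
def σfxy (x : A) (y : Y) : Matrix (Total R S A B C) (Total R S A B C) ℂ :=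
  (evolve (extend splitSA (𝓔.Udec x y : Matrix (S × A) (S × A) ℂ))
      ((𝓔.pX x : ℂ) • 𝓔.instr x y (𝓔.σ1 x))).submatrix swapA swapA

theorem posSemidef_smul_instr (x : A) (y : Y) :
    ((𝓔.pX x : ℂ) • 𝓔.instr x y (𝓔.σ1 x)).PosSemidef :=
  posSemidef_ofReal_smul (𝓔.posSemidef_instr x y (𝓔.posSemidef_σ1 x)) (𝓔.pX_nonneg x)

theorem posSemidef_σfxy (x : A) (y : Y) : (𝓔.σfxy x y).PosSemidef :=
  (posSemidef_evolve _ (𝓔.posSemidef_smul_instr x y)).submatrix _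

theorem isometry_Udec (x : A) (y : Y) :
    (extend (splitSA (R := R) (B := B) (C := C)) (𝓔.Udec x y : Matrix (S × A) (S × A) ℂ))ᴴ *
    extend (splitSA (R := R) (B := B) (C := C)) (𝓔.Udec x y : Matrix (S × A) (S × A) ℂ) = 1 :=
  extend_isometry _ (unitary_isometry _)

theorem trace_submatrix_equiv {I J : Type*} [Fintype I] [Fintype J] (e : J ≃ I)
    (ρ : Matrix I I ℂ) : (ρ.submatrix e e).trace = ρ.trace := by
  simp only [trace, diag, submatrix_apply]
  exact e.sum_comp fun i => ρ i i

theorem trace_σfxy (x : A) (y : Y) : (𝓔.σfxy x y).trace = ((𝓔.pX x * 𝓔.pY x y : ℝ) : ℂ) := by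
  rw [σfxy, trace_submatrix_equiv, trace_evolve (𝓔.isometry_Udec x y), trace_smul, trace_instr,
    smul_eq_mul, Complex.ofReal_mul]

theorem entropy_σfxy (x : A) (y : Y) :
    entropy (𝓔.σfxy x y) = 𝓔.pX x * entropy (𝓔.instr x y (𝓔.σ1 x)) +
      negMulLog (𝓔.pX x) * 𝓔.pY x y := by
  rw [σfxy, entropy_submatrix _ (posSemidef_evolve _ (𝓔.posSemidef_smul_instr x y)).isHermitian,
    entropy_evolve (𝓔.isometry_Udec x y) (𝓔.posSemidef_smul_instr x y).isHermitian,
    entropy_smul (𝓔.posSemidef_instr x y (𝓔.posSemidef_σ1 x))]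
  rfl

theorem σfEXY_eq : 𝓔.σfEXY = blockDiagonal fun z => 𝓔.σfxy z.1 z.2 := by
  ext ⟨i, z⟩ ⟨j, w⟩
  by_cases h : z = w <;> simp [σfEXY, σ3EXY, σfxy, blockDiagonal_apply, h]

theorem entropy_σfEXY : entropy 𝓔.σfEXY = ∑ x, ∑ y, entropy (𝓔.σfxy x y) := by
  have h : ∀ z : A × Y, (𝓔.σfxy z.1 z.2).IsHermitian := fun z =>
    (𝓔.posSemidef_σfxy z.1 z.2).isHermitian
  rw [σfEXY_eq, entropy_blockDiagonal h, Fintype.sum_prod_type]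

theorem σfEX_eq : 𝓔.σfEX = blockDiagonal fun x => ∑ y, 𝓔.σfxy x y := by
  rw [σfEX, σfEXY_eq]
  ext ⟨i, x⟩ ⟨j, x'⟩
  by_cases h : x = x' <;>
    simp [reduce, splitEX, blockDiagonal_apply, h, Matrix.sum_apply]

theorem entropy_σfEX : entropy 𝓔.σfEX = ∑ x, entropy (∑ y, 𝓔.σfxy x y) := by
  rw [σfEX_eq, entropy_blockDiagonal fun x =>
    (posSemidef_sum _ fun y _ => 𝓔.posSemidef_σfxy x y).isHermitian]

theorem σ2XY_eq : 𝓔.σ2XY = diagonal fun z => ((𝓔.pX z.1 * 𝓔.pY z.1 z.2 : ℝ) : ℂ) := by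
  rw [σ2XY, σ2EXY, reduce_prodComm_blockDiagonal]
  congr 1; ext1 z
  rw [trace_smul, trace_instr, smul_eq_mul, Complex.ofReal_mul]

theorem reduce_σ2XY [Nonempty A] [Nonempty B] [Nonempty C] [Nonempty M] :
    reduce (Equiv.refl _) 𝓔.σ2XY = diagonal fun x => (𝓔.pX x : ℂ) := by
  rw [σ2XY_eq]
  ext x x'
  by_cases h : x = x'
  · subst h
    simp [reduce, ← Finset.mul_sum, ← Complex.ofReal_sum, 𝓔.sum_pY]
  · simp [reduce, h]

theorem condY_X_eq [Nonempty A] [Nonempty B] [Nonempty C] [Nonempty M] : 𝓔.condY_X =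
    ∑ x, ∑ y, negMulLog (𝓔.pX x * 𝓔.pY x y) - ∑ x, negMulLog (𝓔.pX x) := by
  rw [condY_X, reduce_σ2XY, σ2XY_eq, entropy_diagonal, entropy_diagonal, Fintype.sum_prod_type]

/-- Conditioning on `E` cannot raise the entropy of the syndrome: this is Holevo's bound in each
block `x`. -/
theorem condY_EX_le [Nonempty A] [Nonempty B] [Nonempty C] [Nonempty M] :
    𝓔.condY_EX ≤ 𝓔.condY_X := by
  rw [condY_X_eq, condY_EX, entropy_σfEXY, entropy_σfEX, ← Finset.sum_sub_distrib,
    ← Finset.sum_sub_distrib]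
  refine Finset.sum_le_sum fun x _ => ?_
  have := sum_entropy_le fun y => 𝓔.posSemidef_σfxy x y
  simp only [trace_σfxy, Complex.ofReal_re, ← Finset.mul_sum, sum_pY, mul_one] at this
  linarith

/-- Correction and swap are unitary in every branch, so after the noise only the measurement can
change the entropy of `EXY`, and the efficacy condition excludes a decrease. The entropy of `X`
supplies the term of `τA`. -/
theorem le_entropy_σfEXY [Nonempty A] [Nonempty B] [Nonempty C] [Nonempty M]
    (h : ∀ x, 𝓔.instrumentEfficacy x ≤ 1) :
    entropy 𝓔.τA + entropy 𝓔.τHot + entropy 𝓔.τCold ≤ entropy 𝓔.σfEXY := by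
  rw [entropy_σfEXY]
  simp only [entropy_σfxy, Finset.sum_add_distrib, ← Finset.mul_sum, sum_pY, mul_one]
  have : ∑ x, 𝓔.pX x * (entropy 𝓔.τHot + entropy 𝓔.τCold) ≤
      ∑ x, 𝓔.pX x * ∑ y, entropy (𝓔.instr x y (𝓔.σ1 x)) :=
    Finset.sum_le_sum fun x _ => mul_le_mul_of_nonneg_left
      ((𝓔.entropy_σ1 x).symm.trans_le (𝓔.entropy_σ1_le x (h x))) (𝓔.pX_nonneg x)
  rw [← Finset.sum_mul, sum_pX, one_mul] at this
  rw [entropy_τA]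
  linarith

/-! #### Marginals of the final state -/

/-- The state of `E` after the error correction, before the ancilla is reset. -/
def σ3E : Matrix (Total R S A B C) (Total R S A B C) ℂ := reduce (Equiv.refl _) 𝓔.σ3EXY

theorem σfE_eq : 𝓔.σfE = 𝓔.σ3E.submatrix swapA swapA := rfl

theorem σfE_eq_sum : 𝓔.σfE = ∑ z : A × Y, 𝓔.σfxy z.1 z.2 := by
  rw [σfE, σfEXY_eq, reduce_blockDiagonal]

theorem posSemidef_σfE : 𝓔.σfE.PosSemidef := by
  rw [σfE_eq_sum]
  exact posSemidef_sum _ fun z _ => 𝓔.posSemidef_σfxy z.1 z.2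

theorem trace_σfE [Nonempty A] [Nonempty B] [Nonempty C] [Nonempty M] : 𝓔.σfE.trace = 1 := by
  rw [σfE_eq_sum, trace_sum]
  simp only [trace_σfxy]
  rw [← Complex.ofReal_sum, Fintype.sum_prod_type]
  simp only [← Finset.mul_sum, sum_pY, mul_one, sum_pX, Complex.ofReal_one]

/-- Measurement and error correction do not change the state of the systems other than `SA`. -/
theorem reduce_compl_σ3E [Nonempty M] :
    reduce (compl splitSA) 𝓔.σ3E = ∑ x, (𝓔.pX x : ℂ) • reduce (compl splitSA) (𝓔.σ1 x) := by
  rw [σ3E, σ3EXY, reduce_blockDiagonal, reduce_sum, Fintype.sum_prod_type]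
  refine Finset.sum_congr rfl fun x _ => ?_
  -- The correction depends on `y` but acts on `SA` alone, so it disappears before the sum over
  -- outcomes is taken; that sum then removes the projectors.
  simp only [reduce_compl_evolve splitSA (unitary_isometry _), reduce_smul]
  rw [← Finset.smul_sum, ← reduce_sum, sum_instr]
  congr 1
  have h : ∀ ρ : Matrix (Total R S A B C × M) (Total R S A B C × M) ℂ,
      reduce (compl splitSA) (reduce (Equiv.refl _) ρ) = reduce (compl splitSAM) ρ := fun ρ =>
    reduce_reduce _ _ _ (Equiv.refl _) (fun _ _ _ => rfl) ρ
  rw [h, interact, reduce_compl_evolve splitSAM (unitary_isometry _), ← h, reduce_kronecker_left,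
    𝓔.isGibbs_τM.trace_eq_one, one_smul]

/-- For a splitting that lists `SA` last, the partial trace factors through the complement of `SA`.
The primed splittings below put the baths into this form. -/
theorem reduce_σ3E_of_compl [Nonempty M] {K L : Type*} [Fintype K] [Fintype L] [DecidableEq K]
    [DecidableEq L] (f : R × B × A × C ≃ K × L) (g : Total R S A B C ≃ K × (L × (S × A)))
    (h : ∀ k l sa, g.symm (k, (l, sa)) = (compl splitSA).symm (f.symm (k, l), sa)) :
    reduce g 𝓔.σ3E = ∑ x, (𝓔.pX x : ℂ) • reduce g (𝓔.σ1 x) := by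
  have h' := fun ρ => reduce_reduce (compl splitSA) f g (Equiv.refl _) h ρ
  rw [← h', reduce_compl_σ3E, reduce_sum]
  simp only [reduce_smul, h']

/-- From `E` to the cold bath `A'C`, and the rest with `SA` last. -/
def splitCold' : Total R S A B C ≃ (A × C) × ((R × B) × (S × A)) where
  toFun i := (i.2, ((i.1.1.1, i.1.2), i.1.1.2))
  invFun j := (((j.2.1.1, j.2.2), j.2.1.2), j.1)
  left_inv _ := rfl
  right_inv _ := rfl

/-- From `E` to the hot bath, and the rest with `SA` last. -/
def splitHot' : Total R S A B C ≃ B × ((R × A × C) × (S × A)) where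
  toFun i := (i.1.2, ((i.1.1.1, i.2), i.1.1.2))
  invFun j := (((j.2.1.1, j.2.2), j.1), j.2.1.2)
  left_inv _ := rfl
  right_inv _ := rfl

theorem reduce_splitHot_eq (ρ : Matrix (Total R S A B C) (Total R S A B C) ℂ) :
    reduce splitHot ρ = reduce splitHot' ρ :=
  reduce_equiv splitHot splitHot' (Equiv.refl _)
    ⟨fun i => ((i.1.1, i.2), i.1.2), fun j => ((j.1.1, j.2), j.1.2), fun _ => rfl, fun _ => rfl⟩
    (fun _ _ => rfl) ρ

theorem reduce_splitCold_eq (ρ : Matrix (Total R S A B C) (Total R S A B C) ℂ) :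
    reduce splitCold ρ = reduce splitCold' ρ :=
  reduce_equiv splitCold splitCold' (Equiv.refl _)
    ⟨fun i => ((i.1.1, i.2), i.1.2), fun j => ((j.1.1, j.2), j.1.2), fun _ => rfl, fun _ => rfl⟩
    (fun _ _ => rfl) ρ

theorem reduce_splitHot_σ3E [Nonempty M] :
    reduce splitHot 𝓔.σ3E = ∑ x, (𝓔.pX x : ℂ) • reduce splitHot (𝓔.σ1 x) := by
  simp only [reduce_splitHot_eq]
  exact 𝓔.reduce_σ3E_of_compl ⟨fun i => (i.2.1, (i.1, i.2.2)), fun j => (j.2.1, j.1, j.2.2),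
    fun _ => rfl, fun _ => rfl⟩ splitHot' fun _ _ _ => rfl

theorem reduce_splitCold_σ1 [Nonempty B] (x : A) : reduce splitCold (𝓔.σ1 x) = 𝓔.τCold := by
  rw [splitCold, σ1_eq, reduce_kronecker_right, trace_σnoise, one_smul]

theorem reduce_splitCold_σ3E [Nonempty A] [Nonempty B] [Nonempty M] :
    reduce splitCold 𝓔.σ3E = 𝓔.τCold := by
  have h : reduce splitCold' 𝓔.σ3E = ∑ x, (𝓔.pX x : ℂ) • reduce splitCold' (𝓔.σ1 x) :=
    𝓔.reduce_σ3E_of_compl ⟨fun i => (i.2.2, (i.1, i.2.1)), fun j => (j.2.1, j.2.2, j.1),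
      fun _ => rfl, fun _ => rfl⟩ splitCold' fun _ _ _ => rfl
  rw [reduce_splitCold_eq, h]
  simp only [← reduce_splitCold_eq, reduce_splitCold_σ1]
  rw [← Finset.sum_smul, ← Complex.ofReal_sum, sum_pX, Complex.ofReal_one, one_smul]

theorem reduce_splitHot_σfE : reduce splitHot 𝓔.σfE = reduce splitHot 𝓔.σ3E := by
  rw [σfE_eq]
  exact reduce_equiv (I := Total R S A B C) (J := Total R S A B C) (K := B)
    (L := (R × S × A) × (A × C)) (N := (R × S × A) × (A × C))
    splitHot splitHot swapA
    ⟨fun i => ((i.1.1, i.1.2.1, i.2.1), (i.1.2.2, i.2.2)),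
      fun i => ((i.1.1, i.1.2.1, i.2.1), (i.1.2.2, i.2.2)), fun _ => rfl, fun _ => rfl⟩
    (fun _ _ => rfl) 𝓔.σ3E

/-- From `E` to the ancilla and the rest. -/
def splitA : Total R S A B C ≃ A × (R × S) × (B × A × C) where
  toFun i := (i.1.1.2.2, (i.1.1.1, i.1.1.2.1), (i.1.2, i.2))
  invFun j := (((j.2.1.1, j.2.1.2, j.1), j.2.2.1), j.2.2.2)
  left_inv _ := rfl
  right_inv _ := rfl

/-- From `E` to the copy of the ancilla in the cold bath and the rest. -/
def splitA' : Total R S A B C ≃ A × C × ((R × S × A) × B) where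
  toFun i := (i.2.1, i.2.2, i.1)
  invFun j := (j.2.2, (j.1, j.2.1))
  left_inv _ := rfl
  right_inv _ := rfl

/-- From `E` to `C` and the rest. -/
def splitC : Total R S A B C ≃ C × A × ((R × S × A) × B) where
  toFun i := (i.2.2, i.2.1, i.1)
  invFun j := (j.2.2, (j.2.1, j.1))
  left_inv _ := rfl
  right_inv _ := rfl

/-- From `E` to the system and the rest. -/
def splitS : Total R S A B C ≃ S × A × (R × B × A × C) where
  toFun i := (i.1.1.2.1, i.1.1.2.2, (i.1.1.1, i.1.2, i.2))
  invFun j := (((j.2.2.1, j.1, j.2.1), j.2.2.2.1), j.2.2.2.2)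
  left_inv _ := rfl
  right_inv _ := rfl

/-- This and the next three lemmas record the swap: the marginals of `A` and `A'` are exchanged,
those of `C` and `S` are kept. Since the Hamiltonians at this stage have no interaction terms, these
marginals determine all the energies. -/
theorem reduce_splitA_σfE : reduce splitA 𝓔.σfE = reduce splitA' 𝓔.σ3E := by
  rw [σfE_eq]
  exact reduce_equiv splitA splitA' swapA
    ⟨fun i => (i.2.2.2, ((i.1.1, i.1.2, i.2.2.1), i.2.1)),
      fun j => ((j.2.1.1, j.2.1.2.1), j.2.2, j.2.1.2.2, j.1), fun _ => rfl, fun _ => rfl⟩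
    (fun _ _ => rfl) 𝓔.σ3E

theorem reduce_splitA'_σfE : reduce splitA' 𝓔.σfE = reduce splitA 𝓔.σ3E := by
  rw [σfE_eq]
  exact reduce_equiv splitA' splitA swapA
    ⟨fun j => ((j.2.1.1, j.2.1.2.1), j.2.2, j.2.1.2.2, j.1),
      fun i => (i.2.2.2, ((i.1.1, i.1.2, i.2.2.1), i.2.1)), fun _ => rfl, fun _ => rfl⟩
    (fun _ _ => rfl) 𝓔.σ3E

theorem reduce_splitC_σfE : reduce splitC 𝓔.σfE = reduce splitC 𝓔.σ3E := by
  rw [σfE_eq]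
  exact reduce_equiv (I := Total R S A B C) (J := Total R S A B C) (K := C)
    (L := A × ((R × S × A) × B)) (N := A × ((R × S × A) × B)) splitC splitC swapA
    ⟨fun j => (j.2.1.2.2, ((j.2.1.1, j.2.1.2.1, j.1), j.2.2)),
      fun j => (j.2.1.2.2, ((j.2.1.1, j.2.1.2.1, j.1), j.2.2)), fun _ => rfl, fun _ => rfl⟩
    (fun _ _ => rfl) 𝓔.σ3E

theorem reduce_splitS_σfE : reduce splitS 𝓔.σfE = reduce splitS 𝓔.σ3E := by
  rw [σfE_eq]
  exact reduce_equiv splitS splitS swapA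
    ⟨fun j => (j.2.2.2.1, (j.2.1, j.2.2.1, j.1, j.2.2.2.2)),
      fun j => (j.2.2.2.1, (j.2.1, j.2.2.1, j.1, j.2.2.2.2)), fun _ => rfl, fun _ => rfl⟩
    (fun _ _ => rfl) 𝓔.σ3E

theorem reduce_splitCold_left (ρ : Matrix (Total R S A B C) (Total R S A B C) ℂ) :
    reduce (Equiv.refl _) (reduce splitCold ρ) = reduce splitA' ρ :=
  reduce_reduce _ _ _ (Equiv.refl _) (fun _ _ _ => rfl) ρ

theorem reduce_splitCold_right (ρ : Matrix (Total R S A B C) (Total R S A B C) ℂ) :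
    reduce (Equiv.prodComm _ _) (reduce splitCold ρ) = reduce splitC ρ :=
  reduce_reduce _ _ _ (Equiv.refl _) (fun _ _ _ => rfl) ρ

theorem reduce_splitSA_left (ρ : Matrix (Total R S A B C) (Total R S A B C) ℂ) :
    reduce (Equiv.refl _) (reduce splitSA ρ) = reduce splitS ρ :=
  reduce_reduce _ _ _ (Equiv.refl _) (fun _ _ _ => rfl) ρ

theorem reduce_splitSA_right (ρ : Matrix (Total R S A B C) (Total R S A B C) ℂ) :
    reduce (Equiv.prodComm _ _) (reduce splitSA ρ) = reduce splitA ρ :=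
  reduce_reduce _ _ _
    ⟨fun j => ((j.2.1, j.1), j.2.2.1, j.2.2.2.1, j.2.2.2.2),
      fun j => (j.1.2, (j.1.1, j.2.1, j.2.2.1, j.2.2.2)), fun _ => rfl, fun _ => rfl⟩
    (fun _ _ _ => rfl) ρ

/-- From `E` to the baths and the rest. -/
def splitBath : Total R S A B C ≃ (B × A × C) × (A × (R × S)) where
  toFun i := ((i.1.2, i.2), (i.1.1.2.2, (i.1.1.1, i.1.1.2.1)))
  invFun j := (((j.2.2.1, j.2.2.2, j.2.1), j.1.1), j.1.2)
  left_inv _ := rfl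
  right_inv _ := rfl

/-- The ancilla is reset to its initial thermal state. -/
theorem reduce_splitA_σfE_eq [Nonempty A] [Nonempty B] [Nonempty C] [Nonempty M] :
    reduce splitA 𝓔.σfE = 𝓔.τA := by
  rw [reduce_splitA_σfE, ← reduce_splitCold_left, reduce_splitCold_σ3E, τCold,
    reduce_kronecker_left, (isGibbs_thermal _ 𝓔.HC_herm).trace_eq_one, one_smul]

/-- The entropy of the final state is at most the sum of the entropies of its parts. -/
theorem entropy_σfE_le [Nonempty A] [Nonempty B] [Nonempty C] [Nonempty M] :
    entropy 𝓔.σfE ≤ 𝓔.entropyExchange + entropy 𝓔.τA + entropy (reduce splitHot 𝓔.σfE) +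
      entropy (reduce splitCold 𝓔.σfE) := by
  have h1 := entropy_subadditive splitRS 𝓔.posSemidef_σfE
  have p1 := posSemidef_reduce (compl splitRS) 𝓔.posSemidef_σfE
  have h2 := entropy_subadditive (Equiv.refl (A × B × A × C)) p1
  have p2 := posSemidef_reduce (compl (Equiv.refl (A × B × A × C))) p1
  have h3 := entropy_subadditive (Equiv.refl (B × A × C)) p2
  -- Three applications of subadditivity separate `RS`, `A`, the hot bath and the cold bath; at
  -- trace one the correction term of each is zero.
  simp only [trace_reduce, trace_σfE, Complex.one_re, negMulLog_one, add_zero] at h1 h2 h3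
  have e1 : reduce (Equiv.refl (A × B × A × C)) (reduce (compl splitRS) 𝓔.σfE) = 𝓔.τA := by
    rw [← reduce_splitA_σfE_eq]
    exact reduce_reduce _ _ _ (Equiv.prodComm _ _) (fun _ _ _ => rfl) _
  have e0 : reduce (compl (Equiv.refl (A × B × A × C))) (reduce (compl splitRS) 𝓔.σfE) =
      reduce splitBath 𝓔.σfE :=
    reduce_reduce _ _ _ (Equiv.refl _) (fun _ _ _ => rfl) _
  have e2 : reduce (Equiv.refl (B × A × C)) (reduce splitBath 𝓔.σfE) = reduce splitHot 𝓔.σfE :=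
    reduce_reduce _ _ _ ⟨fun j => ((j.2.2.1, j.2.2.2, j.2.1), j.1),
      fun j => (j.2, (j.1.2.2, (j.1.1, j.1.2.1))), fun _ => rfl, fun _ => rfl⟩
      (fun _ _ _ => rfl) _
  have e3 : reduce (compl (Equiv.refl (B × A × C))) (reduce splitBath 𝓔.σfE) =
      reduce splitCold 𝓔.σfE :=
    reduce_reduce _ _ _ ⟨fun j => ((j.2.2.1, j.2.2.2, j.2.1), j.1),
      fun j => (j.2, (j.1.2.2, (j.1.1, j.1.2.1))), fun _ => rfl, fun _ => rfl⟩
      (fun _ _ _ => rfl) _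
  rw [e1, e0] at h2
  rw [e0, e2, e3] at h3
  rw [entropyExchange, σfRS]
  linarith

end Engine

/-! ### Energy of non-interacting systems. -/

section Composite

variable {I J K L K' L' : Type*} [Fintype I] [DecidableEq I] [Fintype J] [DecidableEq J]
  [Fintype K] [DecidableEq K] [Fintype L] [DecidableEq L] [Fintype K'] [DecidableEq K']
  [Fintype L'] [DecidableEq L']

/-- Mean energy of two systems that do not interact. -/
theorem expectation_free (H : Matrix I I ℂ) (H' : Matrix J J ℂ) (ρ : Matrix (I × J) (I × J) ℂ) :
    expectation (H ⊗ₖ (1 : Matrix J J ℂ) + (1 : Matrix I I ℂ) ⊗ₖ H') ρ =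
      expectation H (reduce (Equiv.refl _) ρ) + expectation H' (reduce (Equiv.prodComm _ _) ρ) := by
  rw [expectation_add_left, expectation_reduce, expectation_reduce,
    Engine.one_kronecker_eq_extend]
  rfl

theorem expectation_diagonal (h d : I → ℝ) :
    expectation (diagonal fun i => (h i : ℂ)) (diagonal fun i => (d i : ℂ)) = ∑ i, d i * h i := by
  rw [expectation, diagonal_mul_diagonal, trace_diagonal]
  simp

end Composite

/-! ### Energy balance, measurement heat and the efficiency bound. -/

namespace Engine

variable {R S A B C M Y : Type*}
    [Fintype R] [Fintype S] [Fintype A] [Fintype B] [Fintype C] [Fintype M] [Fintype Y]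
    [DecidableEq R] [DecidableEq S] [DecidableEq A] [DecidableEq B] [DecidableEq C]
    [DecidableEq M] [DecidableEq Y]
    (𝓔 : Engine R S A B C M Y)

/-! #### First law -/

/-- The thermal ancilla is diagonal in its energy basis, so measuring it there does not disturb the
average state. -/
theorem U0_eq_Ui : 𝓔.U0 = 𝓔.Ui := by
  have h : ∀ x, reduce splitRSA (𝓔.σ0 x) =
      reduce (Equiv.prodComm R S) (pureState 𝓔.ψ) ⊗ₖ single x x (1 : ℂ) := by
    intro x
    ext ⟨s, a⟩ ⟨s', a'⟩
    simp only [reduce, σ0, pureState, splitRSA, of_apply, Equiv.coe_fn_symm_mk, vecMulVec_apply,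
      Pi.star_apply, kroneckerMap_apply, single_apply, Finset.sum_mul, Equiv.prodComm_symm,
      Equiv.prodComm_apply, Prod.swap_prod_mk, eq_comm (a := x)]
    refine Finset.sum_congr rfl fun r _ => ?_
    by_cases h : a = x <;> by_cases h' : a' = x <;> simp [h, h']
  have hτ : 𝓔.τA = ∑ x, (𝓔.pX x : ℂ) • single x x (1 : ℂ) := by
    rw [τA, ← Matrix.sum_single_eq_diagonal]
    simp [smul_single]
  rw [U0, Ui, hτ]
  congr 1
  have : reduce (Equiv.prodComm R S) (pureState 𝓔.ψ) ⊗ₖ ∑ x, (𝓔.pX x : ℂ) • single x x (1 : ℂ) =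
      ∑ x, (𝓔.pX x : ℂ) • reduce splitRSA (𝓔.σ0 x) := by
    ext i j
    simp only [h, kroneckerMap_apply, Matrix.sum_apply, Finset.mul_sum, Matrix.smul_apply, smul_eq_mul]
    exact Finset.sum_congr rfl fun x _ => by ring
  rw [this, expectation_sum]
  simp only [expectation_smul]

/-- From `RSAB` to `SA` and `RB`. -/
def splitRB : (R × S × A) × B ≃ (S × A) × (R × B) where
  toFun i := ((i.1.2.1, i.1.2.2), (i.1.1, i.2))
  invFun j := ((j.2.1, j.1.1, j.1.2), j.2.2)
  left_inv _ := rfl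
  right_inv _ := rfl

theorem expectation_extend_splitRSAB_free (ρ : Matrix ((R × S × A) × B) ((R × S × A) × B) ℂ) :
    expectation (extend splitRSAB
        (𝓔.HSA ⊗ₖ (1 : Matrix B B ℂ) + (1 : Matrix (S × A) (S × A) ℂ) ⊗ₖ 𝓔.HB)) ρ =
      expectation 𝓔.HSA (reduce splitRB ρ) + expectation 𝓔.HB (reduce (Equiv.prodComm _ _) ρ) := by
  rw [← expectation_reduce, expectation_free,
    reduce_reduce splitRSAB (Equiv.refl _) splitRB (Equiv.prodComm _ _) (fun _ _ _ => rfl),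
    reduce_reduce splitRSAB (Equiv.prodComm _ _) (Equiv.prodComm _ B)
      (⟨fun j => (j.2, j.1.1, j.1.2), fun j => ((j.2.1, j.2.2), j.1), fun _ => rfl,
        fun _ => rfl⟩ : (S × A) × R ≃ R × S × A) (fun _ _ _ => rfl)]

/-- The noise conserves the energy of `SA` and the hot bath. -/
theorem noise_energy [Nonempty A] [Nonempty B] [Nonempty C] (x : A) :
    expectation 𝓔.HSA (reduce splitSA (𝓔.σ1 x)) + expectation 𝓔.HB (reduce splitHot (𝓔.σ1 x)) =
      expectation 𝓔.HSA (reduce splitRSA (𝓔.σenc x)) + expectation 𝓔.HB 𝓔.τHot := by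
  have h0 : reduce (Equiv.refl _) (𝓔.σ1 x) = 𝓔.σnoise x := by
    rw [σ1_eq, reduce_kronecker_left, 𝓔.isGibbs_τCold.trace_eq_one, one_smul]
  have h1 : reduce splitSA (𝓔.σ1 x) = reduce splitRB (𝓔.σnoise x) := by
    rw [← h0]
    exact (reduce_reduce _ _ _ ⟨fun j => (j.1.1, j.1.2, j.2.1, j.2.2),
      fun j => ((j.1, j.2.1), (j.2.2.1, j.2.2.2)), fun _ => rfl, fun _ => rfl⟩
      (fun _ _ _ => rfl) _).symm
  have h2 : reduce splitHot (𝓔.σ1 x) = reduce (Equiv.prodComm _ _) (𝓔.σnoise x) := by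
    rw [← h0]
    exact (reduce_reduce _ _ _ (Equiv.refl _) (fun _ _ _ => rfl) _).symm
  have h3 : reduce splitRB (𝓔.σenc x ⊗ₖ 𝓔.τHot) = reduce splitRSA (𝓔.σenc x) := by
    have := reduce_kronecker_left (𝓔.σenc x) 𝓔.τHot
    rw [𝓔.isGibbs_τHot.trace_eq_one, one_smul] at this
    conv_rhs => rw [← this]
    exact (reduce_reduce _ _ _ (Equiv.refl _) (fun _ _ _ => rfl) _).symm
  have h4 : reduce (Equiv.prodComm _ _) (𝓔.σenc x ⊗ₖ 𝓔.τHot) = 𝓔.τHot := by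
    rw [reduce_kronecker_right, trace_σenc, one_smul]
  rw [h1, h2, ← expectation_extend_splitRSAB_free, σnoise, expectation_evolve
    (extend_isometry _ (unitary_isometry _)), expectation_extend_splitRSAB_free, h3, h4]
  rw [← extend_mul, ← extend_mul, 𝓔.Uh_comm.eq]

theorem meanY_blockDiagonal {F : A × Y → Matrix (Total R S A B C) (Total R S A B C) ℂ}
    {q : A × Y → ℝ} (h : ∀ z, (F z).trace = (q z : ℂ)) :
    𝓔.meanY (blockDiagonal F) = ∑ z, q z * 𝓔.energyY z.2 := by
  rw [meanY, reduce_prodComm_blockDiagonal]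
  simp only [h]
  exact expectation_diagonal _ _

theorem U1_eq [Nonempty A] [Nonempty B] [Nonempty C] :
    𝓔.U1 = ∑ x, 𝓔.pX x * expectation 𝓔.HSA (reduce splitSA (𝓔.σ1 x)) + 𝓔.energyY 𝓔.y₀ := by
  have h : 𝓔.meanY 𝓔.σ1EXY = 𝓔.energyY 𝓔.y₀ := by
    rw [σ1EXY, 𝓔.meanY_blockDiagonal (q := fun z => if z.2 = 𝓔.y₀ then 𝓔.pX z.1 else 0) fun z => by
      split_ifs <;> simp [trace_σ1], Fintype.sum_prod_type]
    simp [← Finset.sum_mul, sum_pX]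
  rw [U1, h, partSA, σ1EXY, reduce_blockDiagonal, Fintype.sum_prod_type]
  simp only [Finset.sum_ite_eq', Finset.mem_univ, if_true, reduce_sum, reduce_smul,
    expectation_sum, expectation_smul]

/-- The hot bath is untouched after the noise, so the heat defined with the final state is the
energy it lost during the noise. -/
theorem Qh_eq [Nonempty A] [Nonempty M] : 𝓔.Qh = ∑ x, 𝓔.pX x *
    (expectation 𝓔.HB 𝓔.τHot - expectation 𝓔.HB (reduce splitHot (𝓔.σ1 x))) := by
  rw [Qh, reduce_splitHot_σfE, reduce_splitHot_σ3E, expectation_sum]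
  simp only [expectation_smul, mul_sub, Finset.sum_sub_distrib, ← Finset.sum_mul, sum_pX, one_mul]

theorem U1_sub_Uencoded [Nonempty A] [Nonempty B] [Nonempty C] [Nonempty M] :
    𝓔.U1 - 𝓔.Uencoded = 𝓔.Qh := by
  rw [U1_eq, Uencoded, Qh_eq, add_sub_add_right_eq_sub, ← Finset.sum_sub_distrib]
  refine Finset.sum_congr rfl fun x _ => ?_
  rw [← mul_sub]
  congr 1
  have := 𝓔.noise_energy x
  linarith

theorem meanY_σfEXY_eq : 𝓔.meanY 𝓔.σfEXY = 𝓔.meanY 𝓔.σ3EXY := by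
  rw [meanY, meanY]
  congr 1
  exact reduce_equiv (Equiv.prodComm _ _) (Equiv.prodComm _ _)
    (Equiv.prodCongr swapA (Equiv.refl (A × Y))) swapA (fun _ _ => rfl) 𝓔.σ3EXY

theorem expectation_HSAfree (ρ : Matrix (Total R S A B C) (Total R S A B C) ℂ) :
    expectation 𝓔.HSAfree (reduce splitSA ρ) =
      expectation 𝓔.HS (reduce splitS ρ) + expectation 𝓔.HA (reduce splitA ρ) := by
  rw [HSAfree, expectation_free, reduce_splitSA_left, reduce_splitSA_right]

theorem expectation_HCold (ρ : Matrix (Total R S A B C) (Total R S A B C) ℂ) :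
    expectation 𝓔.HCold (reduce splitCold ρ) =
      expectation 𝓔.HA (reduce splitA' ρ) + expectation 𝓔.HC (reduce splitC ρ) := by
  rw [HCold, expectation_free, reduce_splitCold_left, reduce_splitCold_right]

/-- The swap only exchanges the energies of `A` and `A'`: what `SA` gains the cold bath loses. -/
theorem Uerase_sub_U3 [Nonempty A] [Nonempty B] [Nonempty M] :
    𝓔.Uerase - 𝓔.U3 = 𝓔.Qc + 𝓔.Qerase := by
  rw [Uerase, U3, Qc, Qerase, meanY_σfEXY_eq, ← 𝓔.reduce_splitCold_σ3E, expectation_HCold,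
    expectation_HCold, show partSA 𝓔.σfEXY = reduce splitSA 𝓔.σfE from rfl,
    show partSA 𝓔.σ3EXY = reduce splitSA 𝓔.σ3E from rfl, expectation_HSAfree, expectation_HSAfree,
    reduce_splitS_σfE, reduce_splitC_σfE, reduce_splitA_σfE, reduce_splitA'_σfE]
  ring

theorem neg_Wtot_eq [Nonempty A] [Nonempty B] [Nonempty C] [Nonempty M] :
    -𝓔.Wtot = 𝓔.Qmeas + 𝓔.Qh + 𝓔.Qc + 𝓔.Qerase - 𝓔.ΔU := by
  have h1 := 𝓔.U1_sub_Uencoded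
  have h2 := 𝓔.Uerase_sub_U3
  have h3 := 𝓔.U0_eq_Ui
  simp only [Wtot, Wenc, Wmeas, Wdec, ΔU]
  linarith

theorem Qerase_nonpos [Nonempty A] [Nonempty B] [Nonempty C] [Nonempty M] : 𝓔.Qerase ≤ 0 := by
  rw [Qerase, σfEXY_eq, 𝓔.meanY_blockDiagonal fun z => 𝓔.trace_σfxy z.1 z.2, sub_nonpos]
  calc 𝓔.energyY 𝓔.y₀ = ∑ z : A × Y, 𝓔.pX z.1 * 𝓔.pY z.1 z.2 * 𝓔.energyY 𝓔.y₀ := by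
        rw [← Finset.sum_mul, Fintype.sum_prod_type]
        simp only [← Finset.mul_sum, sum_pY, mul_one, sum_pX, one_mul]
    _ ≤ _ := Finset.sum_le_sum fun z _ => mul_le_mul_of_nonneg_left (𝓔.ground z.2)
        (mul_nonneg (𝓔.pX_nonneg z.1) (𝓔.pY_nonneg z.1 z.2))

/-! #### The heat of the measurement apparatus -/

/-- The isometry that copies the outcome of the projective measurement of `M` into `Y`. -/
def copyY (K : Type*) [DecidableEq K] (x : A) : Matrix ((K × M) × Y) (K × M) ℂ :=
  Matrix.of fun i j => ((1 : Matrix K K ℂ) ⊗ₖ 𝓔.P x i.2) i.1 j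

variable {K : Type*} [Fintype K] [DecidableEq K]

theorem conjTranspose_one_kronecker_P (x : A) (y : Y) :
    ((1 : Matrix K K ℂ) ⊗ₖ 𝓔.P x y)ᴴ = (1 : Matrix K K ℂ) ⊗ₖ 𝓔.P x y := by
  rw [conjTranspose_kronecker, conjTranspose_one, (𝓔.P_herm x y).eq]

theorem copyY_isometry (x : A) : (𝓔.copyY K x)ᴴ * 𝓔.copyY K x = 1 := by
  have h : (𝓔.copyY K x)ᴴ * 𝓔.copyY K x =
      ∑ y, ((1 : Matrix K K ℂ) ⊗ₖ 𝓔.P x y)ᴴ * ((1 : Matrix K K ℂ) ⊗ₖ 𝓔.P x y) := by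
    ext i j
    rw [mul_apply, Fintype.sum_prod_type, Finset.sum_comm, Matrix.sum_apply]
    rfl
  rw [h]
  simp only [conjTranspose_one_kronecker_P, ← mul_kronecker_mul, P_mul_self, Matrix.one_mul]
  have : ∑ y, (1 : Matrix K K ℂ) ⊗ₖ 𝓔.P x y = (1 : Matrix K K ℂ) ⊗ₖ ∑ y, 𝓔.P x y := by
    ext i j
    simp only [Matrix.sum_apply, kroneckerMap_apply, Finset.mul_sum]
  rw [this, 𝓔.P_sum, one_kronecker_one]

theorem copyY_conj_apply (x : A) (ρ : Matrix (K × M) (K × M) ℂ) (i j : (K × M) × Y) :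
    (𝓔.copyY K x * ρ * (𝓔.copyY K x)ᴴ) i j =
      (((1 : Matrix K K ℂ) ⊗ₖ 𝓔.P x i.2) * ρ * ((1 : Matrix K K ℂ) ⊗ₖ 𝓔.P x j.2)) i.1 j.1 := by
  conv_rhs => rw [← conjTranspose_one_kronecker_P 𝓔 x j.2]
  rfl

theorem σ2EMY_eq (x : A) : 𝓔.σ2EMY x = 𝓔.copyY (Total R S A B C) x * 𝓔.interact x (𝓔.σ1 x) *
    (𝓔.copyY (Total R S A B C) x)ᴴ := by
  ext i j
  rw [copyY_conj_apply]
  rfl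

theorem posSemidef_σ2EMY (x : A) : (𝓔.σ2EMY x).PosSemidef := by
  rw [σ2EMY_eq]
  exact (𝓔.posSemidef_interact x (𝓔.posSemidef_σ1 x)).mul_mul_conjTranspose_same _

theorem trace_σ2EMY [Nonempty A] [Nonempty B] [Nonempty C] [Nonempty M] (x : A) :
    (𝓔.σ2EMY x).trace = 1 := by
  rw [σ2EMY_eq, Matrix.trace_mul_comm, ← Matrix.mul_assoc, copyY_isometry, Matrix.one_mul,
    trace_interact, trace_σ1]

/-- From `E` to `RSA` and the baths. -/
def splitBaths : Total R S A B C ≃ (R × S × A) × (B × A × C) := Equiv.prodAssoc _ _ _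

/-- From `EM` to `RSAM` and the baths. -/
def splitBathsM : Total R S A B C × M ≃ ((R × S × A) × M) × (B × A × C) where
  toFun i := ((i.1.1.1, i.2), (i.1.1.2, i.1.2))
  invFun j := (((j.1.1, j.2.1), j.2.2), j.1.2)
  left_inv _ := rfl
  right_inv _ := rfl

/-- From `EMY` to `RSAMY` and the baths. -/
def splitBathsMY : (Total R S A B C × M) × Y ≃ (((R × S × A) × M) × Y) × (B × A × C) where
  toFun i := (((i.1.1.1.1, i.1.2), i.2), (i.1.1.1.2, i.1.1.2))
  invFun j := ((((j.1.1.1, j.2.1), j.2.2), j.1.1.2), j.1.2)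
  left_inv _ := rfl
  right_inv _ := rfl

/-- From `RSAM` to `SAM` and `R`. -/
def splitR : (R × S × A) × M ≃ ((S × A) × M) × R where
  toFun i := (((i.1.2.1, i.1.2.2), i.2), i.1.1)
  invFun j := ((j.2, j.1.1.1, j.1.1.2), j.1.2)
  left_inv _ := rfl
  right_inv _ := rfl

theorem extend_splitBathsM (T : Matrix M M ℂ) :
    (1 : Matrix (Total R S A B C) (Total R S A B C) ℂ) ⊗ₖ T =
      extend splitBathsM ((1 : Matrix (R × S × A) (R × S × A) ℂ) ⊗ₖ T) := by
  ext ⟨⟨⟨i, b⟩, c⟩, m⟩ ⟨⟨⟨i', b'⟩, c'⟩, m'⟩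
  simp only [extend_apply, splitBathsM, kroneckerMap_apply, one_apply, Equiv.coe_fn_mk,
    Prod.mk.injEq]
  split_ifs <;> simp_all

theorem extend_splitSAM (T : Matrix ((S × A) × M) ((S × A) × M) ℂ) :
    extend (splitSAM (R := R) (B := B) (C := C)) T = extend splitBathsM (extend splitR T) := by
  ext ⟨⟨⟨⟨r, s, a⟩, b⟩, ⟨t, c⟩⟩, m⟩ ⟨⟨⟨⟨r', s', a'⟩, b'⟩, ⟨t', c'⟩⟩, m'⟩
  simp only [extend_apply, splitBathsM, splitR, splitSAM, splitSA, Equiv.coe_fn_mk,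
    Prod.mk.injEq]
  split_ifs <;> simp_all

/-- Interaction and copying do not touch the baths, so they commute with tracing the baths out.
Hence `RSAM` evolves isometrically into `RSAMY`, and its entropy stays that of the uncorrelated
input. -/
theorem reduce_σ2EMY (x : A) : reduce splitBathsMY (𝓔.σ2EMY x) =
    𝓔.copyY (R × S × A) x * reduce splitBathsM (𝓔.interact x (𝓔.σ1 x)) *
      (𝓔.copyY (R × S × A) x)ᴴ := by
  ext i j
  rw [copyY_conj_apply, ← reduce_extend_mul, ← reduce_mul_extend, ← extend_splitBathsM,
    ← extend_splitBathsM]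
  rfl

/-- State of `RSA` after the noise, given `x`. -/
def σ1RSA (x : A) : Matrix (R × S × A) (R × S × A) ℂ := reduce splitBaths (𝓔.σ1 x)

theorem posSemidef_σ1RSA (x : A) : (𝓔.σ1RSA x).PosSemidef :=
  posSemidef_reduce _ (𝓔.posSemidef_σ1 x)

theorem trace_σ1RSA [Nonempty A] [Nonempty B] [Nonempty C] (x : A) : (𝓔.σ1RSA x).trace = 1 := by
  rw [σ1RSA, trace_reduce, trace_σ1]

theorem entropy_reduce_σ2EMY [Nonempty A] [Nonempty B] [Nonempty C] [Nonempty M] (x : A) :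
    entropy (reduce splitBathsMY (𝓔.σ2EMY x)) = entropy (𝓔.σ1RSA x) + entropy 𝓔.τM := by
  have h : reduce splitBathsM (𝓔.σ1 x ⊗ₖ 𝓔.τM) = 𝓔.σ1RSA x ⊗ₖ 𝓔.τM := by
    ext ⟨i, m⟩ ⟨i', m'⟩
    simp only [σ1RSA, reduce, of_apply, kroneckerMap_apply, Finset.sum_mul]
    rfl
  have hp := (𝓔.posSemidef_σ1RSA x).kronecker 𝓔.isGibbs_τM.posSemidef
  rw [reduce_σ2EMY, interact, extend_splitSAM, reduce_evolve, h,
    entropy_isometry (𝓔.copyY_isometry x) (posSemidef_evolve _ hp).isHermitian,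
    entropy_evolve (extend_isometry _ (unitary_isometry _)) hp.isHermitian,
    entropy_kronecker (𝓔.posSemidef_σ1RSA x) 𝓔.isGibbs_τM.posSemidef, trace_σ1RSA,
    𝓔.isGibbs_τM.trace_eq_one]
  simp

theorem sum_entropy_smul [Nonempty A] {I : Type*} [Fintype I] [DecidableEq I]
    {ρ : A → Matrix I I ℂ} (h : ∀ x, (ρ x).PosSemidef) (h1 : ∀ x, (ρ x).trace = 1) :
    ∑ x, entropy ((𝓔.pX x : ℂ) • ρ x) = ∑ x, 𝓔.pX x * entropy (ρ x) + entropy 𝓔.τA := by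
  simp only [entropy_smul (h _), h1, Complex.one_re, mul_one, Finset.sum_add_distrib, entropy_τA]

theorem entropy_cq [Nonempty A] {I : Type*} [Fintype I] [DecidableEq I]
    {ρ : A → Matrix I I ℂ} (h : ∀ x, (ρ x).PosSemidef) (h1 : ∀ x, (ρ x).trace = 1) :
    entropy (blockDiagonal fun x => (𝓔.pX x : ℂ) • ρ x) =
      ∑ x, 𝓔.pX x * entropy (ρ x) + entropy 𝓔.τA := by
  rw [entropy_blockDiagonal fun x => (posSemidef_ofReal_smul (h x) (𝓔.pX_nonneg x)).isHermitian,
    sum_entropy_smul 𝓔 h h1]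

theorem entropy_σ2RSAMYX [Nonempty A] [Nonempty B] [Nonempty C] [Nonempty M] :
    entropy 𝓔.σ2RSAMYX =
      ∑ x, 𝓔.pX x * (entropy (𝓔.σ1RSA x) + entropy 𝓔.τM) + entropy 𝓔.τA := by
  have hp : ∀ x, (reduce splitBathsMY (𝓔.σ2EMY x)).PosSemidef := fun x =>
    posSemidef_reduce _ (𝓔.posSemidef_σ2EMY x)
  have h1 : ∀ x, (reduce splitBathsMY (𝓔.σ2EMY x)).trace = 1 := fun x => by
    rw [trace_reduce, trace_σ2EMY]
  have hc := 𝓔.entropy_cq hp h1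
  simp only [entropy_reduce_σ2EMY] at hc
  rw [← hc, ← entropy_submatrix (⟨fun i => (((i.1, i.2.1), i.2.2.1), i.2.2.2),
    fun j => (j.1.1.1, j.1.1.2, j.1.2, j.2), fun _ => rfl, fun _ => rfl⟩ :
      (R × S × A) × M × Y × A ≃ (((R × S × A) × M) × Y) × A)
    (isHermitian_blockDiagonal fun x =>
      (posSemidef_ofReal_smul (hp x) (𝓔.pX_nonneg x)).isHermitian)]
  congr 1
  ext ⟨i, m, y, x⟩ ⟨i', m', y', x'⟩
  by_cases hx : x = x'
  · subst hx
    simp [σ2RSAMYX, σ2EMYX, reduce, splitRSAMYX, splitBathsMY, blockDiagonal_apply,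
      Finset.mul_sum]
  · simp [σ2RSAMYX, σ2EMYX, reduce, splitRSAMYX, blockDiagonal_apply, hx]

/-- From `EMY` to the apparatus and the rest. -/
def splitM : (Total R S A B C × M) × Y ≃ M × (Total R S A B C × Y) where
  toFun i := (i.1.2, (i.1.1, i.2))
  invFun j := ((j.2.1, j.1), j.2.2)
  left_inv _ := rfl
  right_inv _ := rfl

/-- State of the apparatus after the syndrome measurement, given `x`. -/
def σ2M (x : A) : Matrix M M ℂ := reduce splitM (𝓔.σ2EMY x)

theorem posSemidef_σ2M (x : A) : (𝓔.σ2M x).PosSemidef :=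
  posSemidef_reduce _ (𝓔.posSemidef_σ2EMY x)

theorem trace_σ2M [Nonempty A] [Nonempty B] [Nonempty C] [Nonempty M] (x : A) :
    (𝓔.σ2M x).trace = 1 := by
  rw [σ2M, trace_reduce, trace_σ2EMY]

/-- From `EMYX` to `MYX` and the rest. -/
def splitMYX : ((Total R S A B C × M) × Y) × A ≃ (M × Y × A) × Total R S A B C where
  toFun i := ((i.1.1.2, i.1.2, i.2), i.1.1.1)
  invFun j := (((j.2, j.1.1), j.1.2.1), j.1.2.2)
  left_inv _ := rfl
  right_inv _ := rfl

/-- From `EMYX` to `MX` and the rest. -/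
def splitMX : ((Total R S A B C × M) × Y) × A ≃ (M × A) × (Total R S A B C × Y) where
  toFun i := ((i.1.1.2, i.2), (i.1.1.1, i.1.2))
  invFun j := (((j.2.1, j.1.1), j.2.2), j.1.2)
  left_inv _ := rfl
  right_inv _ := rfl

theorem σ2MYX_eq : 𝓔.σ2MYX = reduce splitMYX 𝓔.σ2EMYX :=
  reduce_reduce _ _ _ ⟨fun j => ((j.1, j.2.1), j.2.2), fun j => (j.1.1, (j.1.2, j.2)),
    fun _ => rfl, fun _ => rfl⟩ (fun _ _ _ => rfl) _

theorem reduce_σ2MYX : reduce ((Equiv.prodCongrRight fun _ => Equiv.prodComm Y A).trans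
    (Equiv.prodAssoc M A Y).symm) 𝓔.σ2MYX = blockDiagonal fun x => (𝓔.pX x : ℂ) • 𝓔.σ2M x := by
  rw [σ2MYX_eq, reduce_reduce splitMYX _ splitMX (Equiv.prodComm _ _) (fun _ _ _ => rfl), σ2EMYX,
    reduce_blockDiagonal_of_quantum splitM splitMX (fun _ _ _ => rfl)]
  simp only [reduce_smul, σ2M]

theorem reduce_σ2MYX_refl :
    reduce (Equiv.refl _) 𝓔.σ2MYX = ∑ x, (𝓔.pX x : ℂ) • 𝓔.σ2M x := by
  rw [← reduce_blockDiagonal, ← reduce_σ2MYX]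
  exact (reduce_reduce _ _ _ (Equiv.prodComm _ _) (fun _ _ _ => rfl) _).symm

theorem condRSA_XY_σ1EXY [Nonempty A] [Nonempty B] [Nonempty C] :
    condRSA_XY 𝓔.σ1EXY = ∑ x, 𝓔.pX x * entropy (𝓔.σ1RSA x) := by
  have h1 : reduce splitRSAXY 𝓔.σ1EXY = blockDiagonal fun z : A × Y =>
      if z.2 = 𝓔.y₀ then (𝓔.pX z.1 : ℂ) • 𝓔.σ1RSA z.1 else 0 := by
    rw [σ1EXY, reduce_blockDiagonal_of_quantum splitBaths splitRSAXY (fun _ _ _ => rfl)]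
    congr 1; ext1 z
    split_ifs
    · rw [reduce_smul]; rfl
    · ext; simp [reduce]
  have h2 : reduce (Equiv.prodComm _ _) 𝓔.σ1EXY = diagonal fun z : A × Y =>
      ((if z.2 = 𝓔.y₀ then 𝓔.pX z.1 else 0 : ℝ) : ℂ) := by
    rw [σ1EXY, reduce_prodComm_blockDiagonal]
    congr 1; ext1 z
    split_ifs <;> simp [trace_σ1]
  have h3 : ∀ z : A × Y,
      (if z.2 = 𝓔.y₀ then (𝓔.pX z.1 : ℂ) • 𝓔.σ1RSA z.1 else 0).IsHermitian := fun z => by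
    split_ifs
    · exact (posSemidef_ofReal_smul (𝓔.posSemidef_σ1RSA z.1) (𝓔.pX_nonneg z.1)).isHermitian
    · exact isHermitian_zero
  rw [condRSA_XY, h1, h2, entropy_diagonal, entropy_blockDiagonal h3, Fintype.sum_prod_type,
    Fintype.sum_prod_type]
  simp only [apply_ite entropy, apply_ite negMulLog, entropy_zero, negMulLog_zero,
    Finset.sum_ite_eq', Finset.mem_univ, if_true]
  rw [𝓔.sum_entropy_smul 𝓔.posSemidef_σ1RSA 𝓔.trace_σ1RSA, entropy_τA, add_sub_cancel_right]

/-- The heat drawn from the apparatus is bounded by the measurement heats of `Y` and `RSA`. -/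
theorem Qmeas_le [Nonempty A] [Nonempty B] [Nonempty C] [Nonempty M] :
    𝓔.Qmeas ≤ 𝓔.QmeasY + 𝓔.QmeasRSA := by
  -- In the sum of the two heats the entropies of `X`, `XY`, `MYX` and `RSAXY` cancel. What remains,
  -- H(RSAMYX) - H(MX) - H(RSA|XY) with the last term taken before the measurement, is the mean
  -- entropy drop of the apparatus given `x`.
  have h1 : 𝓔.QmeasY + 𝓔.QmeasRSA =
      ∑ x, 𝓔.pX x * (𝓔.kB * 𝓔.Tm * (entropy 𝓔.τM - entropy (𝓔.σ2M x))) := by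
    have : ∑ x, 𝓔.pX x * (𝓔.kB * 𝓔.Tm * (entropy 𝓔.τM - entropy (𝓔.σ2M x))) =
        𝓔.kB * 𝓔.Tm * (∑ x, 𝓔.pX x * (entropy (𝓔.σ1RSA x) + entropy 𝓔.τM) -
          ∑ x, 𝓔.pX x * entropy (𝓔.σ2M x) - ∑ x, 𝓔.pX x * entropy (𝓔.σ1RSA x)) := by
      rw [← Finset.sum_sub_distrib, ← Finset.sum_sub_distrib, Finset.mul_sum]
      exact Finset.sum_congr rfl fun x _ => by ring
    rw [this, QmeasY, QmeasRSA, condY_X, mutualYM_X, mutualRSAM_XY, condRSA_XY_σ1EXY, reduce_σ2MYX,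
      𝓔.entropy_cq 𝓔.posSemidef_σ2M 𝓔.trace_σ2M, entropy_σ2RSAMYX, condRSA_XY,
      show reduce (Equiv.prodComm _ _) 𝓔.σ2EXY = 𝓔.σ2XY from rfl]
    ring
  have h2 : 𝓔.Qmeas = ∑ x, 𝓔.pX x * (expectation 𝓔.HM 𝓔.τM - expectation 𝓔.HM (𝓔.σ2M x)) := by
    rw [Qmeas, reduce_σ2MYX_refl, expectation_sum]
    simp only [expectation_smul, mul_sub, Finset.sum_sub_distrib, ← Finset.sum_mul, sum_pX, one_mul]
  rw [h1, h2]
  refine Finset.sum_le_sum fun x _ => mul_le_mul_of_nonneg_left ?_ (𝓔.pX_nonneg x)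
  have := 𝓔.isGibbs_τM.variational 𝓔.θm_pos (𝓔.posSemidef_σ2M x) (𝓔.trace_σ2M x)
  linarith

/-! #### Second law, fidelity and efficiency -/

/-- A Clausius inequality for the cycle, in which the entropy exchange and the two conditional
entropies of the registers stand for the entropy that is not in the baths. The entropy of the
ancilla cancels because the swap resets it. -/
theorem clausius [Nonempty A] [Nonempty B] [Nonempty C] [Nonempty M]
    (h : ∀ x, 𝓔.instrumentEfficacy x ≤ 1) :
    𝓔.Qh / (𝓔.kB * 𝓔.Th) + 𝓔.Qc / (𝓔.kB * 𝓔.Tc) ≤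
      𝓔.entropyExchange + 𝓔.condX_E + 𝓔.condY_EX := by
  have hh := 𝓔.isGibbs_τHot.variational 𝓔.θh_pos (posSemidef_reduce splitHot 𝓔.posSemidef_σfE)
    (by rw [trace_reduce, trace_σfE])
  have hc := 𝓔.isGibbs_τCold.variational 𝓔.θc_pos
    (posSemidef_reduce splitCold 𝓔.posSemidef_σfE) (by rw [trace_reduce, trace_σfE])
  have h1 : 𝓔.Qh / (𝓔.kB * 𝓔.Th) ≤ entropy 𝓔.τHot - entropy (reduce splitHot 𝓔.σfE) := by
    rw [div_le_iff₀ 𝓔.θh_pos, Qh]; linarith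
  have h2 : 𝓔.Qc / (𝓔.kB * 𝓔.Tc) ≤ entropy 𝓔.τCold - entropy (reduce splitCold 𝓔.σfE) := by
    rw [div_le_iff₀ 𝓔.θc_pos, Qc]; linarith
  have h3 := 𝓔.entropy_σfE_le
  have h4 := 𝓔.le_entropy_σfEXY h
  rw [condX_E, condY_EX]
  linarith

theorem fidelity_le_maxFidelity [Nonempty A] [Nonempty B] [Nonempty C] [Nonempty M] :
    𝓔.fidelity ≤ 𝓔.maxFidelity := by
  -- Here d is already the dimension of `RS`, for which Fano needs only d - 1; replacing it by d² -
  -- 1 weakens the bound.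
  have hD : (Fintype.card (R × S) : ℝ) - 1 ≤
      ((Fintype.card S * Fintype.card R : ℕ) : ℝ) ^ 2 - 1 := by
    rw [Fintype.card_prod, mul_comm (Fintype.card R)]
    exact sub_le_sub_right (by exact_mod_cast Nat.le_self_pow two_ne_zero _) 1
  obtain ⟨h0, h1, h2⟩ := entropy_le_fano (ρ := 𝓔.σfRS) (posSemidef_reduce _ 𝓔.posSemidef_σfE)
    (by rw [σfRS, trace_reduce, trace_σfE]) 𝓔.ψ_norm hD 𝓔.fidelity rfl
  exact le_fanoMaximum h0 h1 h2

theorem maxFidelity_le_one : 𝓔.maxFidelity ≤ 1 := fanoMaximum_le_one _ _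

theorem efficiency_le [Nonempty A] [Nonempty B] [Nonempty C] [Nonempty M]
    {ε : ℝ} (hε₀ : 0 ≤ ε) (hε₁ : ε < 1) (hregime : 𝓔.HeatEngineRegime)
    (h₁ : 𝓔.NegligibleEnergyChange ε) (h₂ : 𝓔.NegligibleMemoryX ε) (h₃ : 𝓔.LandauerReached ε)
    (h₄ : 𝓔.SufficientMeasurementHeat) (heff : ∀ x, 𝓔.instrumentEfficacy x ≤ 1)
    (hF : 𝓔.maxFidelity = 1) :
    𝓔.efficiency ≤ 𝓔.carnot + (ε + 2 * ε * (1 + ε) / (1 - ε)) := by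
  obtain ⟨-, hQc, hRSA, hin⟩ := hregime
  have hSe : 𝓔.entropyExchange ≤ 0 := nonpos_of_fanoMaximum_eq_one hF
  have hTh : 0 < 𝓔.Th := 𝓔.Tc_pos.trans_le 𝓔.Tc_le_Th
  set t := 𝓔.Tc / 𝓔.Th with ht
  have ht1 : t ≤ 1 := (div_le_one hTh).2 𝓔.Tc_le_Th
  set k := 𝓔.kB * 𝓔.Tc * 𝓔.condY_X with hk
  have hcl : t * 𝓔.Qh + 𝓔.Qc ≤ (1 + ε) * k := by
    have h := 𝓔.clausius heff
    have hm : 𝓔.condX_E ≤ ε * 𝓔.condY_EX := h₂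
    have hY := mul_le_mul_of_nonneg_left 𝓔.condY_EX_le (by linarith : 0 ≤ 1 + ε)
    have h' : 𝓔.Qh / (𝓔.kB * 𝓔.Th) + 𝓔.Qc / (𝓔.kB * 𝓔.Tc) ≤ (1 + ε) * 𝓔.condY_X := by linarith
    have h'' := mul_le_mul_of_nonneg_left h' 𝓔.θc_pos.le
    have e1 : 𝓔.kB * 𝓔.Tc * (𝓔.Qh / (𝓔.kB * 𝓔.Th) + 𝓔.Qc / (𝓔.kB * 𝓔.Tc)) =
        t * 𝓔.Qh + 𝓔.Qc := by
      have := 𝓔.kB_pos.ne'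
      have := 𝓔.Tc_pos.ne'
      rw [ht]; field_simp
    rw [e1] at h''
    rw [hk]; linarith
  have hW := 𝓔.neg_Wtot_eq
  have hm := 𝓔.Qmeas_le
  have hU := (abs_le.1 (h₁ : |𝓔.ΔU| ≤ ε * 𝓔.Qinput)).1
  have hL := (abs_le.1 (h₃ : |(|𝓔.Qerase|) - k| ≤ ε * k)).1
  rw [abs_of_nonpos 𝓔.Qerase_nonpos] at hL
  have hS : t * 𝓔.QmeasY ≤ |𝓔.QmeasRSA| := h₄
  rw [abs_of_nonpos hRSA] at hS
  have hQ : 𝓔.Qinput = 𝓔.Qh + 𝓔.QmeasY := rfl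
  have hε : 0 < 1 - ε := by linarith
  rw [efficiency, div_le_iff₀ hin, carnot, ← ht]
  -- Without work output the efficiency is at most 0, and the claimed bound is non-negative. With
  -- work output, the same first law also controls `k`.
  rcases le_total (-𝓔.Wtot) 0 with hneg | hpos
  · refine hneg.trans (mul_nonneg (add_nonneg (by linarith) ?_) hin.le)
    positivity
  -- From 0 ≤ -W, after dropping the non-positive `Qc` and `QmeasRSA` in the first law. This turns
  -- the leftover 2εk of the final estimate into the second term of δ(ε).
  · have hkQ : (1 - ε) * k ≤ (1 + ε) * 𝓔.Qinput := by linarith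
    have hkQ' : k ≤ (1 + ε) / (1 - ε) * 𝓔.Qinput := by
      rw [div_mul_eq_mul_div, le_div_iff₀ hε]; linarith
    have hk2 := mul_le_mul_of_nonneg_left hkQ' (by linarith : 0 ≤ 2 * ε)
    have e : 2 * ε * ((1 + ε) / (1 - ε) * 𝓔.Qinput) = 2 * ε * (1 + ε) / (1 - ε) * 𝓔.Qinput := by
      ring
    have htQ : t * 𝓔.Qinput = t * 𝓔.Qh + t * 𝓔.QmeasY := by rw [hQ]; ring
    rw [add_mul, add_mul, sub_mul, ← e]
    linarith

end Engine

end QECEngine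
end
theorem mainTheorem7 {R S A B C M Y : Type*}
    [Fintype R] [Fintype S] [Fintype A] [Fintype B] [Fintype C] [Fintype M] [Fintype Y]
    [DecidableEq R] [DecidableEq S] [DecidableEq A] [DecidableEq B] [DecidableEq C]
    [DecidableEq M] [DecidableEq Y]
    [Nonempty A] [Nonempty B] [Nonempty C] [Nonempty M]
    (𝓔 : QECEngine.Engine R S A B C M Y) (ε : ℝ) (hε₀ : 0 ≤ ε) (hε₁ : ε < 1)
    (hregime : 𝓔.HeatEngineRegime)
    (h₁ : 𝓔.NegligibleEnergyChange ε)
    (h₂ : 𝓔.NegligibleMemoryX ε)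
    (h₃ : 𝓔.LandauerReached ε)
    (h₄ : 𝓔.SufficientMeasurementHeat)
    (heff : ∀ x, 𝓔.instrumentEfficacy x ≤ 1) :
    𝓔.fidelity ≤ 𝓔.maxFidelity ∧
    (ε = 0 → (𝓔.efficiency > 𝓔.carnot → 𝓔.maxFidelity < 1) ∧
      (𝓔.maxFidelity = 1 → 𝓔.efficiency ≤ 𝓔.carnot)) ∧
    (𝓔.efficiency > 𝓔.carnot + (ε + 2 * ε * (1 + ε) / (1 - ε)) → 𝓔.maxFidelity < 1) ∧
    (𝓔.maxFidelity = 1 → 𝓔.efficiency ≤ 𝓔.carnot + (ε + 2 * ε * (1 + ε) / (1 - ε))) := by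
  have key := 𝓔.efficiency_le hε₀ hε₁ hregime h₁ h₂ h₃ h₄ heff
  have h0 : ε = 0 → 𝓔.maxFidelity = 1 → 𝓔.efficiency ≤ 𝓔.carnot := fun h hF => by
    simpa [h] using key hF
  -- The strict statements are contrapositives of the bound at maximal fidelity 1, since the maximal
  -- fidelity never exceeds 1.
  exact ⟨𝓔.fidelity_le_maxFidelity,
    fun h => ⟨fun hη => lt_of_le_of_ne 𝓔.maxFidelity_le_one fun hF => not_lt.2 (h0 h hF) hη, h0 h⟩,
    fun hη => lt_of_le_of_ne 𝓔.maxFidelity_le_one fun hF => not_lt.2 (key hF) hη, key⟩
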